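/- Let $z_1\ne z_2$ in $\mathbb C$ and $n\ge 0$. Let $\Sigma$ be the rational curve with one cusp $P$ at $z=z_1$ (normalization $\mathbb{CP}^1$, local ring at $P$: functions $f$ regular at $z_1$ with $f'(z_1)=0$), with the smooth marked point $p$ at $z=z_2$ and with dualizing sheaf $\mathcal K$. For $\Lambda\in\mathfrak{gl}_n(\mathbb C)$ let $V=M_\Lambda$ be the rank $n$ bundle on $\Sigma$ that is trivial away from $P$ and whose sections at $P$ are the regular $s$ with $s'(z_1)=\Lambda s(z_1)$; a trivialization at $p$ is a matrix $U\in GL_n(\mathbb C)$. Let $\mathcal M$ be the moduli space of such pairs $(V,U)$, with $T\mathcal M=H^1(\Sigma,\mathrm{End}\,V(-p))$ (Kodaira–Spencer) and $T^*\mathcal M=H^0(\Sigma,\mathrm{End}\,V\otimes\mathcal K\otimes\mathcal O(p))$, dual to each other by Serre's pairing $\langle\Phi,\chi\rangle=\operatorname{Res}_{z_1}\operatorname{Tr}\Phi\chi+\operatorname{Res}_{z_2}\operatorname{Tr}\Phi\chi$. **Lemma.** (a) The sections of $\mathrm{End}\,V\otimes\mathcal K\otimes\mathcal O(p)$ are exactly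 $$\Phi(z)dz=\Big(\frac{\Phi_1}{(z-z_1)^2}+\frac{\Phi_2}{z-z_1}+\frac{\Phi_3}{z-z_2}\Big)dz,\qquad \Phi_2=[\Lambda,\Phi_1],\quad \Phi_3=-\Phi_2,$$ with $\Phi_1$ arbitrary. $T^*\mathcal M$ is the quotient of the space of triples $(\Lambda,U,\Phi_1)$ by the action $(\Lambda,U,\Phi_1)\mapsto(g\Lambda g^{-1},gU,g\Phi_1g^{-1})$ of $GL_n$. Infinitesimally, $H^1(\Sigma,\mathrm{End}\,V(-p))$ is the space of all $(\dot\Lambda,\dot U)$ modulo the vectors $([\xi,\Lambda],\xi U)$, and the pairing of $H^0$ with $H^1$ is perfect. (b) The pull-backs to the space of triples of the canonical $1$-form $\lambda$ of $T^*\mathcal M$ and of the canonical symplectic form $\omega=d\lambda$ are $$\lambda=\operatorname{Tr}\Phi_1d\Lambda-\operatorname{Tr}U^{-1}\Phi_2\,dU,\qquad \omega=\operatorname{Tr}(d\Phi_1\wedge d\Lambda)-\operatorname{Tr}(d(U^{-1}\Phi_2)\wedge dU)=\operatorname{Tr}(d\Phi_1\wedge d\Lambda)+\operatorname{Tr}(d(U^{-1}\Phi_3)\wedge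 dU).$$ The form $\lambda$ is invariant under the action in (a) and vanishes on its orbit directions, and the kernel of $\omega$ at each point consists exactly of these directions. (c) The form $\lambda$ is invariant under the changes of trivialization $h: U\mapsto Uh$. The moment map of this action is $\mu=U^{-1}\Phi_3U=-U^{-1}\Phi_2U$: for the field $\xi_A=(0,UA,0)$ one has $\lambda(\xi_A)=\operatorname{Tr}(\mu A)$ and $\iota_{\xi_A}\omega=-d\operatorname{Tr}(\mu A)$. On the principal cell ($\Lambda$ with distinct eigenvalues) every triple is equivalent under the action in (a) to one with $\Lambda=\operatorname{diag}(x_1,\dots,x_n)$, the $x_i$ distinct, and $$(\Phi_1)_{ii}=p_i,\qquad(\Phi_1)_{ij}=\frac{f_{ij}}{x_i-x_j}\quad(i\ne j),\qquad f=\Phi_2,\quad f_{ii}=0.$$ At the moment level $\mu=\nu$ one has $f=-U\nu U^{-1}$, and conversely all such data with $f_{ii}=0$ occur. For tangent vectors to the level $\mu=\nu$ with diagonal $\dot\Lambda$, $\omega$ is $\sum_i dp_i\wedge dx_i$ plus the coadjoint-orbit term: $$\omega(v,w)=\sum_i(\dot p_i\dot x_i'-\dot p_i'\dot x_i)-\operatorname{Tr}\big(\nu\,[U^{-1}\dot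 U,U^{-1}\dot U']\big).$$ Functions on the cell that are invariant under the action in (a) and under changes of trivialization descend to functions of $(x,p,f)$. With $\iota_{X_G}\omega=-dG$ and $\{F,G\}=dF(X_G)$, their Poisson bracket is the one given by $$\{x_i,p_j\}=\delta_{ij},\qquad\{f_{ij},f_{kl}\}=\delta_{jk}f_{il}-\delta_{il}f_{kj}$$ (other brackets of coordinates zero, evaluated at $f_{ii}=0$). (d) $\operatorname{Tr}\Phi_1^2$, the coefficient of $(z-z_1)^{-4}$ in $\operatorname{Tr}\Phi(z)^2$, is invariant under both actions. In the reduced coordinates it is the spin rational Calogero–Moser Hamiltonian $$\operatorname{Tr}\Phi_1^2=\sum_{i=1}^np_i^2-\sum_{i\ne j}\frac{f_{ij}f_{ji}}{(x_i-x_j)^2}.$$ -/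

import Mathlib

open scoped Matrix

-- Entrywise sup norm; every norm on these finite-dimensional spaces gives the same derivatives.
attribute [local instance] Matrix.normedAddCommGroup Matrix.normedSpace

noncomputable section

namespace CuspHitchin

abbrev Mat (n : ℕ) := Matrix (Fin n) (Fin n) ℂ

/-- Matrices of rational functions on the normalization `ℂP¹` of the curve. -/
abbrev RMat (n : ℕ) := Matrix (Fin n) (Fin n) (RatFunc ℂ)

/-! ### Local expansions of rational functions -/

/-- The coefficient of `(z - c) ^ k` in the Laurent expansion of `f` at `c`. -/
def coeffAt (c : ℂ) (k : ℤ) (f : RatFunc ℂ) : ℂ :=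
  HahnSeries.coeff ((RatFunc.laurent c f : RatFunc ℂ) : LaurentSeries ℂ) k

/-- `f` vanishes at `c` to order at least `m` (it has a pole of order at most `-m`). -/
def OrdAtLeast (c : ℂ) (m : ℤ) (f : RatFunc ℂ) : Prop :=
  ∀ k : ℤ, k < m → coeffAt c k f = 0

/-- `f` vanishes at infinity to order at least `m`. -/
def OrdInftyAtLeast (m : ℤ) (f : RatFunc ℂ) : Prop :=
  f = 0 ∨ f.intDegree ≤ -m

/-- The coefficient of `(z - c) ^ k` of a matrix of rational functions. -/
def matCoeff {n : ℕ} (c : ℂ) (k : ℤ) (A : RMat n) : Mat n :=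
  Matrix.of fun i j => coeffAt c k (A i j)

def MatOrdAtLeast {n : ℕ} (c : ℂ) (m : ℤ) (A : RMat n) : Prop :=
  ∀ i j, OrdAtLeast c m (A i j)

def MatOrdInftyAtLeast {n : ℕ} (m : ℤ) (A : RMat n) : Prop :=
  ∀ i j, OrdInftyAtLeast m (A i j)

/-! ### The cuspidal curve and its bundles

The curve is `ℂP¹` with a cusp `P` at `z = z₁` and a smooth marked point `p` at `z = z₂`. -/

/-- The local ring of the curve at the cusp: regular `f` with `f' (z₁) = 0`. -/
def IsLocalFunction (z₁ : ℂ) (f : RatFunc ℂ) : Prop :=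
  OrdAtLeast z₁ 0 f ∧ coeffAt z₁ 1 f = 0

/-- The stalk at the cusp of the dualizing sheaf: meromorphic forms `α dz` with
`Res (f α dz) = 0` for every function `f` regular on the curve at the cusp. -/
def IsLocalDualizing (z₁ : ℂ) (α : RatFunc ℂ) : Prop :=
  ∀ f, IsLocalFunction z₁ f → coeffAt z₁ (-1) (f * α) = 0

/-- The stalk at the cusp of the bundle `M_Λ`: regular vectors `s` with `s' (z₁) = Λ s (z₁)`.
Away from the cusp the bundle is the trivial one. -/
def InBundle {n : ℕ} (z₁ : ℂ) (L : Mat n) (s : Fin n → RatFunc ℂ) : Prop :=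
  (∀ i, OrdAtLeast z₁ 0 (s i)) ∧
    (fun i => coeffAt z₁ 1 (s i)) = L *ᵥ (fun i => coeffAt z₁ 0 (s i))

/-- The stalk at the cusp of the sheaf of endomorphisms of `M_Λ`. -/
def IsLocalEnd {n : ℕ} (z₁ : ℂ) (L : Mat n) (T : RMat n) : Prop :=
  ∀ s, InBundle z₁ L s → InBundle z₁ L (T *ᵥ s)

/-- The stalk at the cusp of the tensor product of `End M_Λ` with the (locally free) dualizing
sheaf, inside the matrices of meromorphic forms. -/
def localEndDualizing {n : ℕ} (z₁ : ℂ) (L : Mat n) : Submodule ℂ (RMat n) :=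
  Submodule.span ℂ {S | ∃ (α : RatFunc ℂ) (T : RMat n),
    IsLocalDualizing z₁ α ∧ IsLocalEnd z₁ L T ∧ S = α • T}

/-- `F dz` is a global section of `End V ⊗ K ⊗ O(p)`, `V = M_Λ` (`End V` is identified with its
dual by the trace): regular away from `P`, `p`, also at infinity (where `dz` has a double pole),
with at most a simple pole at `p`, and in the stalk of `End V ⊗ K` at the cusp. -/
def IsHiggs {n : ℕ} (z₁ z₂ : ℂ) (L : Mat n) (F : RMat n) : Prop :=
  (∀ c, c ≠ z₁ → c ≠ z₂ → MatOrdAtLeast c 0 F) ∧ MatOrdInftyAtLeast 2 F ∧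
    MatOrdAtLeast z₂ (-1) F ∧ F ∈ localEndDualizing z₁ L

/-- The matrix form `A / (z - z₁)² + B / (z - z₁) + C / (z - z₂)`. -/
def laxForm {n : ℕ} (z₁ z₂ : ℂ) (A B C : Mat n) : RMat n :=
  ((RatFunc.X - RatFunc.C z₁) ^ 2)⁻¹ • A.map RatFunc.C +
    (RatFunc.X - RatFunc.C z₁)⁻¹ • B.map RatFunc.C +
    (RatFunc.X - RatFunc.C z₂)⁻¹ • C.map RatFunc.C

/-- An isomorphism of triples (bundle `M_Λ`, trivialization `U` of its fibre at `p`, Higgs field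
`F`), given on the generic point by an invertible matrix of rational functions. -/
def TripleIso {n : ℕ} (z₁ z₂ : ℂ) (L U : Mat n) (F : RMat n) (L' U' : Mat n) (F' : RMat n) :
    Prop :=
  ∃ K : GL (Fin n) (RatFunc ℂ),
    (∀ c, c ≠ z₁ → MatOrdAtLeast c 0 (K : RMat n) ∧
      MatOrdAtLeast c 0 ((K⁻¹ : GL (Fin n) (RatFunc ℂ)) : RMat n)) ∧
    MatOrdInftyAtLeast 0 (K : RMat n) ∧
    MatOrdInftyAtLeast 0 ((K⁻¹ : GL (Fin n) (RatFunc ℂ)) : RMat n) ∧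
    (∀ s, InBundle z₁ L s ↔ InBundle z₁ L' ((K : RMat n) *ᵥ s)) ∧
    matCoeff z₂ 0 (K : RMat n) * U = U' ∧
    (K : RMat n) * F * ((K⁻¹ : GL (Fin n) (RatFunc ℂ)) : RMat n) = F'

/-! ### Čech description of `H¹(End V (-p))` for the cover by the complement of infinity and the
complement of `{P, p}` -/

/-- Sections of `End V (-p)` on the intersection of the two charts. -/
def IsCochain {n : ℕ} (z₁ z₂ : ℂ) (χ : RMat n) : Prop :=
  ∀ c, c ≠ z₁ → c ≠ z₂ → MatOrdAtLeast c 0 χ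

/-- Sections of `End V (-p)` on the complement of infinity. -/
def IsFiniteSection {n : ℕ} (z₁ z₂ : ℂ) (L : Mat n) (a : RMat n) : Prop :=
  (∀ c, c ≠ z₁ → MatOrdAtLeast c 0 a) ∧ IsLocalEnd z₁ L a ∧ matCoeff z₂ 0 a = 0

/-- Sections of `End V (-p)` on the complement of `{P, p}`. -/
def IsOuterSection {n : ℕ} (z₁ z₂ : ℂ) (b : RMat n) : Prop :=
  (∀ c, c ≠ z₁ → c ≠ z₂ → MatOrdAtLeast c 0 b) ∧ MatOrdInftyAtLeast 0 b

/-- `χ` represents zero in `H¹(End V (-p))`. -/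
def IsCoboundary {n : ℕ} (z₁ z₂ : ℂ) (L : Mat n) (χ : RMat n) : Prop :=
  ∃ a b, IsFiniteSection z₁ z₂ L a ∧ IsOuterSection z₁ z₂ b ∧ χ = a - b

/-- `s₀ + ε s₁` (with `ε² = 0`) lies in the stalk at the cusp of the first-order deformation
`M_(Λ + ε Λ')`: it is regular and its derivative at `z₁` is `Λ + ε Λ'` times its value. -/
def InDeformedBundle {n : ℕ} (z₁ : ℂ) (L L' : Mat n) (s₀ s₁ : Fin n → RatFunc ℂ) : Prop :=
  InBundle z₁ L s₀ ∧ (∀ i, OrdAtLeast z₁ 0 (s₁ i)) ∧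
    (fun i => coeffAt z₁ 1 (s₁ i)) =
      L *ᵥ (fun i => coeffAt z₁ 0 (s₁ i)) + L' *ᵥ (fun i => coeffAt z₁ 0 (s₀ i))

/-- The Kodaira-Spencer correspondence: the cocycle `χ` represents the class in `H¹(End V (-p))`
of the first-order deformation `(Λ + ε Λ', U + ε U')` of the bundle with trivialization `(Λ, U)`.
Here `1 + ε a` and `1 + ε b` are isomorphisms from the trivial deformation on the two charts (the
first one compatible with the trivializations at `p`), and `χ = a - b`. -/
def IsKodairaSpencer {n : ℕ} (z₁ z₂ : ℂ) (L U L' U' : Mat n) (χ : RMat n) : Prop :=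
  ∃ a b : RMat n,
    (∀ c, c ≠ z₁ → MatOrdAtLeast c 0 a) ∧
    (∀ s, InBundle z₁ L s → InDeformedBundle z₁ L L' s (a *ᵥ s)) ∧
    matCoeff z₂ 0 a * U = U' ∧
    IsOuterSection z₁ z₂ b ∧ χ = a - b

/-- Serre's pairing of a Higgs field with a cocycle: the sum of the residues at `P` and `p`. -/
def serrePairing {n : ℕ} (z₁ z₂ : ℂ) (F χ : RMat n) : ℂ :=
  coeffAt z₁ (-1) (F * χ).trace + coeffAt z₂ (-1) (F * χ).trace

/-! ### The phase space before factorization by isomorphisms -/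

/-- Triples `(Λ, U, Φ₁)`; tangent vectors are triples of the same kind. -/
abbrev Phase (n : ℕ) := Mat n × Mat n × Mat n

def lam {n : ℕ} (s : Phase n) : Mat n := s.1

def frm {n : ℕ} (s : Phase n) : Mat n := s.2.1

def phi1 {n : ℕ} (s : Phase n) : Mat n := s.2.2

def phi2 {n : ℕ} (s : Phase n) : Mat n := lam s * phi1 s - phi1 s * lam s

/-- The Higgs field with `Φ₂ = [Λ, Φ₁]` and `Φ₃ = -Φ₂`. -/
def higgs {n : ℕ} (z₁ z₂ : ℂ) (s : Phase n) : RMat n :=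
  laxForm z₁ z₂ (phi1 s) (phi2 s) (-phi2 s)

/-- The action of `g` by isomorphisms of bundles and of `h` by change of trivialization. It is
linear, so the same formula gives the action on tangent vectors. -/
def act {n : ℕ} (g h : GL (Fin n) ℂ) (s : Phase n) : Phase n :=
  ((g : Mat n) * lam s * ((g⁻¹ : GL (Fin n) ℂ) : Mat n), (g : Mat n) * frm s * (h : Mat n),
    (g : Mat n) * phi1 s * ((g⁻¹ : GL (Fin n) ℂ) : Mat n))

/-- The infinitesimal action of `ξ` by isomorphisms of bundles. -/
def infGauge {n : ℕ} (ξ : Mat n) (s : Phase n) : Phase n :=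
  (ξ * lam s - lam s * ξ, ξ * frm s, ξ * phi1 s - phi1 s * ξ)

/-- The infinitesimal change of trivialization. -/
def infFrame {n : ℕ} (A : Mat n) (s : Phase n) : Phase n := (0, frm s * A, 0)

/-- The principal cell: `U` is invertible and the eigenvalues of `Λ` are distinct. -/
def principalCell (n : ℕ) : Set (Phase n) :=
  {s | IsUnit (frm s).det ∧ (lam s).charpoly.roots.Nodup}

/-- `θ` is the pull-back to the triples `(Λ, U, Φ₁)` of the canonical `1`-form of the cotangent
bundle of the moduli space: its value on a tangent vector at the covector `Φ` is the Serre pairing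
of `Φ` with the image of the vector in the tangent space `H¹(End V (-p))` of the moduli space. -/
def IsCanonicalOneForm {n : ℕ} (z₁ z₂ : ℂ) (θ : Phase n → Phase n →L[ℂ] ℂ) : Prop :=
  ∀ s, IsUnit (frm s).det → ∀ v χ,
    IsKodairaSpencer z₁ z₂ (lam s) (frm s) (lam v) (frm v) χ →
      θ s v = serrePairing z₁ z₂ (higgs z₁ z₂ s) χ

/-- The exterior derivative of the `1`-form `θ`. -/
def extD {n : ℕ} (θ : Phase n → Phase n →L[ℂ] ℂ) (s v w : Phase n) : ℂ :=
  extDeriv (fun t => ContinuousAlternatingMap.ofSubsingleton ℂ (Phase n) ℂ (0 : Fin 1) (θ t)) s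
    ![v, w]

/-- The `2`-form `Tr (dA ∧ dB)` for matrix-valued functions `A`, `B`. -/
def trWedge {n : ℕ} (A B : Phase n → Mat n) (s v w : Phase n) : ℂ :=
  (fderiv ℂ A s v * fderiv ℂ B s w).trace - (fderiv ℂ A s w * fderiv ℂ B s v).trace

/-! ### Reduction by changes of the trivialization -/

/-- The moment map of the action by changes of the trivialization. -/
def moment {n : ℕ} (s : Phase n) : Mat n := -((frm s)⁻¹ * phi2 s * frm s)

/-- Coordinates `(x, p, f)` on the reduced space; only the entries `f i j` with `i ≠ j` matter. -/
abbrev Reduced (n : ℕ) := (Fin n → ℂ) × (Fin n → ℂ) × Mat n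

/-- The matrix with diagonal `p` and off-diagonal entries `f i j / (x i - x j)`. -/
def cmMatrix {n : ℕ} (q : Reduced n) : Mat n :=
  Matrix.of fun i j => if i = j then q.2.1 i else q.2.2 i j / (q.1 i - q.1 j)

/-- The point with diagonal `Λ`, trivialization `U` and reduced coordinates `q = (x, p, f)`. -/
def slice {n : ℕ} (U : Mat n) (q : Reduced n) : Phase n :=
  (Matrix.diagonal q.1, U, cmMatrix q)

/-- `X` is the value at `s` of a Hamiltonian vector field of `F` for `ω = dθ`: `ι_X ω = -dF`. -/
def IsHamiltonianVector {n : ℕ} (θ : Phase n → Phase n →L[ℂ] ℂ) (s : Phase n)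
    (F : Phase n → ℂ) (X : Phase n) : Prop :=
  ∀ w, extD θ s X w = -fderiv ℂ F s w

/-- `F`, as a function on the principal cell, is invariant under isomorphisms of bundles (so it is
a function on the cotangent bundle of the moduli space) and under changes of trivialization (so it
descends to the reduced space). -/
def IsInvariant {n : ℕ} (F : Phase n → ℂ) : Prop :=
  ∀ s ∈ principalCell n, ∀ g h : GL (Fin n) ℂ, F (act g h s) = F s

/-- The Poisson bracket at `q = (x, p, f)` determined by the Leibniz rule from
`{x i, p j} = δ i j`, `{f i j, f k l} = δ j k * f i l - δ i l * f k j`, the other brackets of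
coordinates being zero. -/
def spinBracket {n : ℕ} (A B : Reduced n → ℂ) (q : Reduced n) : ℂ :=
  (∑ i, (fderiv ℂ A q (Pi.single i 1, 0, 0) * fderiv ℂ B q (0, Pi.single i 1, 0) -
      fderiv ℂ A q (0, Pi.single i 1, 0) * fderiv ℂ B q (Pi.single i 1, 0, 0))) +
    ∑ i, ∑ j, ∑ k, ∑ l,
      fderiv ℂ A q (0, 0, Matrix.single i j 1) * fderiv ℂ B q (0, 0, Matrix.single k l 1) *
        ((if j = k then q.2.2 i l else 0) - (if i = l then q.2.2 k j else 0))

end CuspHitchin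

end

namespace CuspHitchin

open Polynomial

/-! ### Local expansions -/

/-! Two facts about rational functions on the projective line carry the geometry: a function regular
everywhere is constant (and zero if it vanishes at infinity), and the residues at z₁ and z₂ of a
form regular elsewhere add up to zero. At the cusp, testing a matrix on sections that vanish there
to order 2 or 3 and on affine linear sections turns sheaf membership into conditions on Laurent
coefficients (`forall_inBundle_mulVec_iff`). Thus T lies in End M_Λ when it is regular with T'(z₁) =
[Λ, T(z₁)]. The dualizing sheaf is generated by (z - z₁)⁻² dz, so tensoring with it shifts this
condition by two places. A Higgs field is the sum of its principal parts; the cusp gives Φ₂ = [Λ,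
Φ₁] and the residue theorem gives Φ₃ = -Φ₂. Isomorphisms of triples are regular everywhere, hence
constant matrices.

A cocycle is a polynomial matrix a minus an outer section b. The deformation it represents is read
off from the 1-jet of a at z₁ and its value at z₂, and two splittings of one cocycle differ by a
constant ξ, which is the gauge ambiguity. In Serre's pairing b drops out by the residue theorem,
leaving Tr Φ₁ Λ' - Tr U⁻¹ Φ₂ U' (`serrePairing_laxForm`). This formula gives both the perfectness of
the pairing and the canonical one-form.

Writing the variation of U as ξU removes every inverse from ω (`omega_eq`), so its kernel and its
restriction to moment levels become identities between cyclic traces.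

For the bracket, the differential of an invariant function is Tr(a dΛ) + Tr(c dΦ₁), and gauge
invariance reads [Λ, a] + [Φ₁, c] = 0. This is exactly what makes (c, 0, -a) a Hamiltonian vector
(`omega_of_gradient`), unique up to gauge directions. A gauge transformation by -β, with β solving
an off-diagonal commutator equation, brings it back to diagonal Λ. Its components are then
Hamilton's equations in (x, p) together with the Lie-Poisson equation f' = [f, β]
(`gradient_add_infGauge_eq`, `fderiv_eq_spinBracket`). -/

open scoped RatFunc in
/-- The embedding of rational functions into Laurent series. -/
noncomputable def laurentSeriesHom (F : Type*) [Field F] : RatFunc F →+* LaurentSeries F :=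
  algebraMap (RatFunc F) (LaurentSeries F)

/-- The Laurent expansion at `c` as a ring homomorphism. -/
noncomputable def expand (c : ℂ) : RatFunc ℂ →+* LaurentSeries ℂ :=
  (laurentSeriesHom ℂ).comp (RatFunc.laurent c : RatFunc ℂ →+* RatFunc ℂ)

theorem coeffAt_eq (c : ℂ) (k : ℤ) (f : RatFunc ℂ) : coeffAt c k f = (expand c f).coeff k := rfl

theorem expand_algebraMap (c : ℂ) (p : ℂ[X]) :
    expand c (algebraMap _ _ p) = ((taylor c p : ℂ[X]) : PowerSeries ℂ) := by
  rw [RatFunc.coe_coe, expand, RingHom.comp_apply, RingHom.coe_coe, RatFunc.laurent_algebraMap]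
  rfl

theorem expand_C (c a : ℂ) : expand c (RatFunc.C a) = HahnSeries.C a := by
  rw [← RatFunc.algebraMap_C, expand_algebraMap, taylor_C, Polynomial.coe_C, PowerSeries.coe_C]

theorem expand_X_sub_C_self (c : ℂ) :
    expand c (RatFunc.X - RatFunc.C c) = HahnSeries.single 1 1 := by
  have : (RatFunc.X - RatFunc.C c : RatFunc ℂ) = algebraMap _ _ (X - C c : ℂ[X]) := by simp
  rw [this, expand_algebraMap]
  simp

theorem coeffAt_add (c : ℂ) (k : ℤ) (f g : RatFunc ℂ) :
    coeffAt c k (f + g) = coeffAt c k f + coeffAt c k g := by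
  simp [coeffAt_eq]

theorem coeffAt_sub (c : ℂ) (k : ℤ) (f g : RatFunc ℂ) :
    coeffAt c k (f - g) = coeffAt c k f - coeffAt c k g := by
  simp [coeffAt_eq]

@[simp]
theorem coeffAt_zero (c : ℂ) (k : ℤ) : coeffAt c k 0 = 0 := by
  simp [coeffAt_eq]

theorem coeffAt_sum {ι : Type*} (s : Finset ι) (c : ℂ) (k : ℤ) (f : ι → RatFunc ℂ) :
    coeffAt c k (∑ i ∈ s, f i) = ∑ i ∈ s, coeffAt c k (f i) := by
  simp [coeffAt_eq, HahnSeries.coeff_sum]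

theorem coeffAt_C (c a : ℂ) (k : ℤ) : coeffAt c k (RatFunc.C a) = if k = 0 then a else 0 := by
  rw [coeffAt_eq, expand_C, HahnSeries.C_apply, HahnSeries.coeff_single]
  congr

theorem coeffAt_zpow_mul (c : ℂ) (m k : ℤ) (f : RatFunc ℂ) :
    coeffAt c k ((RatFunc.X - RatFunc.C c) ^ m * f) = coeffAt c (k - m) f := by
  rw [coeffAt_eq, map_mul, map_zpow₀, expand_X_sub_C_self, ← RatFunc.single_zpow,
    HahnSeries.coeff_single_mul, one_mul, coeffAt_eq]

theorem coeffAt_pow_mul (c : ℂ) (m : ℕ) (k : ℤ) (f : RatFunc ℂ) :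
    coeffAt c k ((RatFunc.X - RatFunc.C c) ^ m * f) = coeffAt c (k - m) f := by
  rw [← coeffAt_zpow_mul c m, zpow_natCast]

theorem OrdAtLeast.mono {c : ℂ} {m l : ℤ} {f : RatFunc ℂ} (h : OrdAtLeast c m f) (hl : l ≤ m) :
    OrdAtLeast c l f := fun k hk => h k (hk.trans_le hl)

/-- Pulling out the monomial of exponent m leaves a power series, so orders and low coefficients of
products reduce to multiplication of power series. -/
theorem ordAtLeast_iff {c : ℂ} {m : ℤ} {f : RatFunc ℂ} :
    OrdAtLeast c m f ↔
      ∃ p : PowerSeries ℂ, expand c f = HahnSeries.single m 1 * (p : LaurentSeries ℂ) := by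
  constructor
  · intro h
    refine ⟨PowerSeries.mk fun j => (expand c f).coeff (m + j), ?_⟩
    ext k
    rw [HahnSeries.coeff_single_mul, one_mul, PowerSeries.coeff_coe]
    split_ifs with hk
    · exact h k (by omega)
    · rw [PowerSeries.coeff_mk]
      congr 1
      omega
  · rintro ⟨p, hp⟩ k hk
    rw [coeffAt_eq, hp, HahnSeries.coeff_single_mul, PowerSeries.coeff_coe, if_pos (by omega),
      mul_zero]

theorem ordAtLeast_zero (c : ℂ) (m : ℤ) : OrdAtLeast c m 0 := fun k _ => by simp

theorem OrdAtLeast.add {c : ℂ} {m : ℤ} {f g : RatFunc ℂ} (hf : OrdAtLeast c m f)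
    (hg : OrdAtLeast c m g) : OrdAtLeast c m (f + g) := fun k hk => by
  rw [coeffAt_add, hf k hk, hg k hk, add_zero]

theorem OrdAtLeast.sub {c : ℂ} {m : ℤ} {f g : RatFunc ℂ} (hf : OrdAtLeast c m f)
    (hg : OrdAtLeast c m g) : OrdAtLeast c m (f - g) := fun k hk => by
  rw [coeffAt_sub, hf k hk, hg k hk, sub_zero]

theorem ordAtLeast_sum {ι : Type*} {s : Finset ι} {c : ℂ} {m : ℤ} {f : ι → RatFunc ℂ}
    (h : ∀ i ∈ s, OrdAtLeast c m (f i)) : OrdAtLeast c m (∑ i ∈ s, f i) := fun k hk => by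
  rw [coeffAt_sum]
  exact Finset.sum_eq_zero fun i hi => h i hi k hk

theorem OrdAtLeast.mul {c : ℂ} {l m k : ℤ} {f g : RatFunc ℂ} (hf : OrdAtLeast c l f)
    (hg : OrdAtLeast c m g) (hk : l + m = k) : OrdAtLeast c k (f * g) := by
  obtain ⟨p, hp⟩ := ordAtLeast_iff.1 hf
  obtain ⟨q, hq⟩ := ordAtLeast_iff.1 hg
  refine ordAtLeast_iff.2 ⟨p * q, ?_⟩
  have h1 : (HahnSeries.single (l + m) 1 : LaurentSeries ℂ)
      = HahnSeries.single l 1 * HahnSeries.single m 1 := by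
    rw [HahnSeries.single_mul_single, one_mul]
  rw [map_mul, hp, hq, ← hk, h1, PowerSeries.coe_mul]
  ring

/-- This is the Cauchy product after removal of the two monomials. Only j = 0 and j = 1 are needed,
since a cusp condition involves two consecutive coefficients. -/
theorem coeffAt_mul_aux {c : ℂ} {l m : ℤ} {f g : RatFunc ℂ} (hf : OrdAtLeast c l f)
    (hg : OrdAtLeast c m g) (j : ℕ) :
    coeffAt c (l + m + j) (f * g) =
      ∑ x ∈ Finset.HasAntidiagonal.antidiagonal j,
        coeffAt c (l + x.1) f * coeffAt c (m + x.2) g := by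
  obtain ⟨p, hp⟩ := ordAtLeast_iff.1 hf
  obtain ⟨q, hq⟩ := ordAtLeast_iff.1 hg
  have h1 : (HahnSeries.single (l + m) 1 : LaurentSeries ℂ)
      = HahnSeries.single l 1 * HahnSeries.single m 1 := by
    rw [HahnSeries.single_mul_single, one_mul]
  have h2 : expand c (f * g) = HahnSeries.single (l + m) 1 * ((p * q : PowerSeries ℂ) :
      LaurentSeries ℂ) := by
    rw [map_mul, hp, hq, h1, PowerSeries.coe_mul]
    ring
  have key : ∀ (e : LaurentSeries ℂ) (r : PowerSeries ℂ) (m : ℤ) (i : ℕ),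
      e = HahnSeries.single m 1 * (r : LaurentSeries ℂ) →
      e.coeff (m + i) = PowerSeries.coeff i r := by
    rintro e r m i rfl
    rw [HahnSeries.coeff_single_mul, one_mul, PowerSeries.coeff_coe, if_neg (by omega)]
    congr
    omega
  rw [coeffAt_eq, key _ _ _ _ h2, PowerSeries.coeff_mul]
  refine Finset.sum_congr rfl fun x _ => ?_
  rw [coeffAt_eq, coeffAt_eq, key _ _ _ _ hp, key _ _ _ _ hq]

theorem coeffAt_mul {c : ℂ} {l m k : ℤ} {f g : RatFunc ℂ} (hf : OrdAtLeast c l f)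
    (hg : OrdAtLeast c m g) (hk : l + m = k) :
    coeffAt c k (f * g) = coeffAt c l f * coeffAt c m g := by
  simpa [hk] using coeffAt_mul_aux hf hg 0

theorem coeffAt_mul_succ {c : ℂ} {l m k : ℤ} {f g : RatFunc ℂ} (hf : OrdAtLeast c l f)
    (hg : OrdAtLeast c m g) (hk : l + m + 1 = k) :
    coeffAt c k (f * g) =
      coeffAt c l f * coeffAt c (m + 1) g + coeffAt c (l + 1) f * coeffAt c m g := by
  simpa [hk, Finset.Nat.antidiagonal_succ] using coeffAt_mul_aux hf hg 1

theorem ordAtLeast_algebraMap (c : ℂ) (p : ℂ[X]) : OrdAtLeast c 0 (algebraMap _ _ p) :=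
  ordAtLeast_iff.2 ⟨(taylor c p : ℂ[X]), by simp [expand_algebraMap]⟩

theorem coeffAt_zero_algebraMap (c : ℂ) (p : ℂ[X]) :
    coeffAt c 0 (algebraMap _ _ p) = p.eval c := by
  rw [coeffAt_eq, expand_algebraMap, PowerSeries.coeff_coe, if_neg (by omega)]
  simp

theorem ordAtLeast_C (c a : ℂ) : OrdAtLeast c 0 (RatFunc.C a) := by
  rw [← RatFunc.algebraMap_C]
  exact ordAtLeast_algebraMap c _

theorem ordAtLeast_zpow_mul_iff {c : ℂ} {m l : ℤ} {f : RatFunc ℂ} :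
    OrdAtLeast c l ((RatFunc.X - RatFunc.C c) ^ m * f) ↔ OrdAtLeast c (l - m) f := by
  constructor
  · intro h k hk
    have := h (k + m) (by omega)
    rwa [coeffAt_zpow_mul, add_sub_cancel_right] at this
  · intro h k hk
    rw [coeffAt_zpow_mul]
    exact h _ (by omega)

theorem ordAtLeast_pow_mul_iff {c : ℂ} {m : ℕ} {l : ℤ} {f : RatFunc ℂ} :
    OrdAtLeast c l ((RatFunc.X - RatFunc.C c) ^ m * f) ↔ OrdAtLeast c (l - m) f := by
  rw [← ordAtLeast_zpow_mul_iff, zpow_natCast]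

theorem exists_ordAtLeast (c : ℂ) (f : RatFunc ℂ) : ∃ N : ℕ, OrdAtLeast c (-N) f := by
  refine ⟨(-(expand c f).order).toNat, fun k hk => ?_⟩
  rw [coeffAt_eq]
  exact HahnSeries.coeff_eq_zero_of_lt_order (by omega)

/-- The expansion of z - d at c has constant term c - d ≠ 0, so it is a unit among power series. -/
theorem ordAtLeast_inv_X_sub_C {c d : ℂ} (h : c ≠ d) :
    OrdAtLeast c 0 (RatFunc.X - RatFunc.C d)⁻¹ := by
  set q : PowerSeries ℂ := ((taylor c (X - C d : ℂ[X]) : ℂ[X]) : PowerSeries ℂ) with hq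
  have h0 : PowerSeries.constantCoeff q ≠ 0 := by
    have : PowerSeries.constantCoeff q = c - d := by simp [hq]
    rw [this]
    exact sub_ne_zero.2 h
  refine ordAtLeast_iff.2 ⟨q⁻¹, ?_⟩
  have h1 : expand c (RatFunc.X - RatFunc.C d) = q := by
    rw [hq, ← expand_algebraMap]
    simp
  rw [map_inv₀, h1, show (HahnSeries.single (0 : ℤ) (1 : ℂ) : LaurentSeries ℂ) = 1 from rfl,
    one_mul]
  refine inv_eq_of_mul_eq_one_right ?_
  rw [← PowerSeries.coe_mul, PowerSeries.mul_inv_cancel _ h0, PowerSeries.coe_one]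

/-! ### Global rational functions -/

/-- At a root of the denominator, regularity would force the numerator to vanish too, against
coprimality. Over ℂ a denominator without roots is constant. -/
theorem eq_algebraMap_of_ordAtLeast {f : RatFunc ℂ} (h : ∀ c, OrdAtLeast c 0 f) :
    ∃ p : ℂ[X], f = algebraMap _ _ p := by
  have hd : f.denom.degree = 0 := by
    by_contra hne
    obtain ⟨c, hc⟩ := IsAlgClosed.exists_root _ hne
    have h1 : f * algebraMap _ _ f.denom = algebraMap _ _ f.num := by
      conv_lhs => rw [← RatFunc.num_div_denom f, RatFunc.num_div_denom f]
      have : algebraMap ℂ[X] (RatFunc ℂ) f.denom ≠ 0 :=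
        RatFunc.algebraMap_ne_zero f.denom_ne_zero
      nth_rw 1 [← RatFunc.num_div_denom f]
      field_simp
    have h2 := coeffAt_mul (h c) (ordAtLeast_algebraMap c f.denom) (zero_add 0)
    rw [h1, coeffAt_zero_algebraMap, coeffAt_zero_algebraMap, hc.eq_zero, mul_zero] at h2
    obtain ⟨u, v, huv⟩ := RatFunc.isCoprime_num_denom f
    have := congrArg (Polynomial.eval c) huv
    simp [h2, hc.eq_zero] at this
  have h1 : f.denom = 1 := (RatFunc.monic_denom f).degree_le_zero_iff_eq_one.1 hd.le
  refine ⟨f.num, ?_⟩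
  nth_rw 1 [← RatFunc.num_div_denom f]
  simp [h1]

theorem OrdInftyAtLeast.mono {m l : ℤ} {f : RatFunc ℂ} (h : OrdInftyAtLeast m f) (hl : l ≤ m) :
    OrdInftyAtLeast l f := h.imp_right fun h => by omega

theorem OrdInftyAtLeast.mul {l m k : ℤ} {f g : RatFunc ℂ} (hf : OrdInftyAtLeast l f)
    (hg : OrdInftyAtLeast m g) (hk : l + m = k) : OrdInftyAtLeast k (f * g) := by
  by_cases hf0 : f = 0
  · simp [OrdInftyAtLeast, hf0]
  by_cases hg0 : g = 0
  · simp [OrdInftyAtLeast, hg0]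
  right
  rw [RatFunc.intDegree_mul hf0 hg0]
  have := hf.resolve_left hf0
  have := hg.resolve_left hg0
  omega

theorem OrdInftyAtLeast.add {m : ℤ} {f g : RatFunc ℂ} (hf : OrdInftyAtLeast m f)
    (hg : OrdInftyAtLeast m g) : OrdInftyAtLeast m (f + g) := by
  by_cases hf0 : f = 0
  · simpa [hf0] using hg
  by_cases hg0 : g = 0
  · simpa [hg0] using hf
  by_cases h0 : f + g = 0
  · exact Or.inl h0
  right
  exact (RatFunc.intDegree_add_le hg0 h0).trans
    (max_le (hf.resolve_left hf0) (hg.resolve_left hg0))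

theorem OrdInftyAtLeast.neg {m : ℤ} {f : RatFunc ℂ} (hf : OrdInftyAtLeast m f) :
    OrdInftyAtLeast m (-f) := by
  simpa [OrdInftyAtLeast, RatFunc.intDegree_neg] using hf

theorem OrdInftyAtLeast.sub {m : ℤ} {f g : RatFunc ℂ} (hf : OrdInftyAtLeast m f)
    (hg : OrdInftyAtLeast m g) : OrdInftyAtLeast m (f - g) := by
  rw [sub_eq_add_neg]
  exact hf.add hg.neg

theorem ordInftyAtLeast_zero (m : ℤ) : OrdInftyAtLeast m 0 := Or.inl rfl

theorem ordInftyAtLeast_sum {ι : Type*} {s : Finset ι} {m : ℤ} {f : ι → RatFunc ℂ}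
    (h : ∀ i ∈ s, OrdInftyAtLeast m (f i)) : OrdInftyAtLeast m (∑ i ∈ s, f i) :=
  Finset.sum_induction _ _ (fun _ _ => OrdInftyAtLeast.add) (ordInftyAtLeast_zero m) h

theorem ordInftyAtLeast_C (a : ℂ) : OrdInftyAtLeast 0 (RatFunc.C a) := by
  right
  simp

theorem X_sub_C_ne_zero (c : ℂ) : (RatFunc.X - RatFunc.C c : RatFunc ℂ) ≠ 0 := by
  have : (RatFunc.X - RatFunc.C c : RatFunc ℂ) = algebraMap _ _ (X - C c : ℂ[X]) := by simp
  rw [this]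
  exact RatFunc.algebraMap_ne_zero (Polynomial.X_sub_C_ne_zero c)

theorem ordInftyAtLeast_X_sub_C (c : ℂ) :
    OrdInftyAtLeast (-1) (RatFunc.X - RatFunc.C c) := by
  right
  have : (RatFunc.X - RatFunc.C c : RatFunc ℂ) = algebraMap _ _ (X - C c : ℂ[X]) := by simp
  rw [this, RatFunc.intDegree_polynomial, natDegree_X_sub_C]
  simp

theorem ordInftyAtLeast_inv_X_sub_C_pow (c : ℂ) (k : ℕ) :
    OrdInftyAtLeast k ((RatFunc.X - RatFunc.C c) ^ k)⁻¹ := by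
  right
  have : ((RatFunc.X - RatFunc.C c) ^ k : RatFunc ℂ) = algebraMap _ _ ((X - C c : ℂ[X]) ^ k) := by
    simp
  rw [RatFunc.intDegree_inv, this, RatFunc.intDegree_polynomial, natDegree_pow, natDegree_X_sub_C]
  simp

theorem eq_C_of_ordAtLeast {f : RatFunc ℂ} (h : ∀ c, OrdAtLeast c 0 f)
    (h' : OrdInftyAtLeast 0 f) : ∃ a : ℂ, f = RatFunc.C a := by
  obtain ⟨p, rfl⟩ := eq_algebraMap_of_ordAtLeast h
  obtain h' | h' := h'
  · exact ⟨0, by simp [h']⟩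
  · rw [RatFunc.intDegree_polynomial] at h'
    have : p.natDegree = 0 := by omega
    refine ⟨p.coeff 0, ?_⟩
    rw [← RatFunc.algebraMap_C, ← eq_C_of_natDegree_eq_zero this]

theorem C_eq_zero_of_ordInftyAtLeast {a : ℂ} (h : OrdInftyAtLeast 1 (RatFunc.C a)) : a = 0 := by
  obtain h | h := h
  · simpa using h
  · simp at h

theorem eq_zero_of_ordAtLeast {f : RatFunc ℂ} (h : ∀ c, OrdAtLeast c 0 f)
    (h' : OrdInftyAtLeast 1 f) : f = 0 := by
  obtain ⟨a, rfl⟩ := eq_C_of_ordAtLeast h (h'.mono (by omega))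
  rw [C_eq_zero_of_ordInftyAtLeast h', map_zero]

/-! ### Principal parts and the residue theorem -/

theorem OrdAtLeast.succ {c : ℂ} {m l : ℤ} {f : RatFunc ℂ} (h : OrdAtLeast c m f)
    (h0 : coeffAt c m f = 0) (hl : l = m + 1) : OrdAtLeast c l f := fun k hk => by
  rcases (by omega : k < m ∨ k = m) with h1 | rfl
  · exact h k h1
  · exact h0

theorem coeffAt_inv_pow_mul (c : ℂ) (m : ℕ) (k : ℤ) (f : RatFunc ℂ) :
    coeffAt c k (((RatFunc.X - RatFunc.C c) ^ m)⁻¹ * f) = coeffAt c (k + m) f := by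
  rw [← zpow_natCast, ← zpow_neg, coeffAt_zpow_mul, sub_neg_eq_add]

theorem OrdAtLeast.inv_pow_mul {c : ℂ} {l k : ℤ} {f : RatFunc ℂ} (hf : OrdAtLeast c l f) (m : ℕ)
    (hk : l = k + m) :
    OrdAtLeast c k (((RatFunc.X - RatFunc.C c) ^ m)⁻¹ * f) := fun i hi => by
  rw [coeffAt_inv_pow_mul]
  exact hf _ (by omega)

theorem OrdAtLeast.inv_pow_mul_of_ne {c d : ℂ} {f : RatFunc ℂ} (hf : OrdAtLeast c 0 f)
    (h : c ≠ d) (m : ℕ) : OrdAtLeast c 0 (((RatFunc.X - RatFunc.C d) ^ m)⁻¹ * f) := by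
  induction m with
  | zero => simpa using hf
  | succ m ih =>
    have := (ordAtLeast_inv_X_sub_C h).mul ih (add_zero 0)
    rwa [← mul_assoc, ← mul_inv, ← pow_succ'] at this

theorem ordInftyAtLeast_inv_pow_mul_C (c a : ℂ) (m : ℕ) :
    OrdInftyAtLeast m (((RatFunc.X - RatFunc.C c) ^ m)⁻¹ * RatFunc.C a) :=
  (ordInftyAtLeast_inv_X_sub_C_pow c m).mul (ordInftyAtLeast_C a) (add_zero _)

theorem coeffAt_inv_pow_mul_C (c a : ℂ) (m : ℕ) (k : ℤ) :
    coeffAt c k (((RatFunc.X - RatFunc.C c) ^ m)⁻¹ * RatFunc.C a) =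
      if k + m = 0 then a else 0 := by
  rw [coeffAt_inv_pow_mul, coeffAt_C]

theorem ordAtLeast_inv_pow_mul_C (c a : ℂ) (m : ℕ) :
    OrdAtLeast c (-m) (((RatFunc.X - RatFunc.C c) ^ m)⁻¹ * RatFunc.C a) :=
  (ordAtLeast_C c a).inv_pow_mul m (by omega)

/-- Induction on the pole order at z₁: a leading term a / (z - z₁)^k with k ≥ 2 has no residue at
either point and decays fast enough at infinity, so it can be subtracted until the pole at z₁ is
simple. The bound m at z₂ survives because the subtracted term is regular there. -/
theorem residue_add_residue_eq_zero_of_reduce {z₁ z₂ : ℂ} (hz : z₁ ≠ z₂) {m : ℤ} (hm : m ≤ 0)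
    (H : ∀ f, (∀ c, c ≠ z₁ → c ≠ z₂ → OrdAtLeast c 0 f) → OrdInftyAtLeast 2 f →
      OrdAtLeast z₂ m f → OrdAtLeast z₁ (-1) f → coeffAt z₁ (-1) f + coeffAt z₂ (-1) f = 0)
    (f : RatFunc ℂ) (hf : ∀ c, c ≠ z₁ → c ≠ z₂ → OrdAtLeast c 0 f) (hi : OrdInftyAtLeast 2 f)
    (h2 : OrdAtLeast z₂ m f) : coeffAt z₁ (-1) f + coeffAt z₂ (-1) f = 0 := by
  obtain ⟨N, hN⟩ := exists_ordAtLeast z₁ f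
  replace hN : OrdAtLeast z₁ (-(N + 1 : ℕ)) f := hN.mono (by push_cast; omega)
  induction N generalizing f with
  | zero => exact H f hf hi h2 (by simpa using hN)
  | succ N ih =>
    set a := coeffAt z₁ (-(N + 1 + 1 : ℕ)) f with ha
    set g := ((RatFunc.X - RatFunc.C z₁) ^ (N + 1 + 1))⁻¹ * RatFunc.C a with hg
    have hg2 : OrdAtLeast z₂ 0 g := (ordAtLeast_C z₂ a).inv_pow_mul_of_ne hz.symm _
    have := ih (f - g) (fun c h1 h2 => (hf c h1 h2).sub ((ordAtLeast_C c a).inv_pow_mul_of_ne h1 _))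
      (hi.sub ((ordInftyAtLeast_inv_pow_mul_C _ _ _).mono (by push_cast; omega)))
      (h2.sub (hg2.mono hm))
      ((hN.sub (ordAtLeast_inv_pow_mul_C _ _ _)).succ (by
        rw [coeffAt_sub, coeffAt_inv_pow_mul_C, if_pos (by omega), ha, sub_self])
        (by push_cast; omega))
    rwa [coeffAt_sub, coeffAt_sub, hg2 (-1) (by omega), hg, coeffAt_inv_pow_mul_C,
      if_neg (by push_cast; omega), sub_zero, sub_zero] at this

theorem residue_add_residue_eq_zero_of_simple {z₁ z₂ : ℂ} (hz : z₁ ≠ z₂)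
    (f : RatFunc ℂ) (hf : ∀ c, c ≠ z₁ → c ≠ z₂ → OrdAtLeast c 0 f) (hi : OrdInftyAtLeast 2 f)
    (h1 : OrdAtLeast z₁ (-1) f) (h2 : OrdAtLeast z₂ (-1) f) :
    coeffAt z₁ (-1) f + coeffAt z₂ (-1) f = 0 := by
  set a := coeffAt z₁ (-1) f with ha
  set b := coeffAt z₂ (-1) f with hb
  have hfe : f - ((RatFunc.X - RatFunc.C z₁) ^ 1)⁻¹ * RatFunc.C a -
      ((RatFunc.X - RatFunc.C z₂) ^ 1)⁻¹ * RatFunc.C b = 0 := by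
    refine eq_zero_of_ordAtLeast (fun c => ?_) ?_
    · by_cases hc1 : c = z₁
      · subst hc1
        refine OrdAtLeast.sub (OrdAtLeast.succ (m := -1) (h1.sub (ordAtLeast_inv_pow_mul_C _ _ 1))
          ?_ (by omega)) ((ordAtLeast_C _ _).inv_pow_mul_of_ne hz _)
        rw [coeffAt_sub, coeffAt_inv_pow_mul_C, if_pos (by simp), ha, sub_self]
      by_cases hc2 : c = z₂
      · subst hc2
        rw [sub_right_comm]
        refine OrdAtLeast.sub (OrdAtLeast.succ (m := -1) (h2.sub (ordAtLeast_inv_pow_mul_C _ _ 1))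
          ?_ (by omega)) ((ordAtLeast_C _ _).inv_pow_mul_of_ne hc1 _)
        rw [coeffAt_sub, coeffAt_inv_pow_mul_C, if_pos (by simp), hb, sub_self]
      · exact ((hf c hc1 hc2).sub ((ordAtLeast_C _ _).inv_pow_mul_of_ne hc1 _)).sub
          ((ordAtLeast_C _ _).inv_pow_mul_of_ne hc2 _)
    · exact ((hi.mono (by omega)).sub (ordInftyAtLeast_inv_pow_mul_C _ _ 1)).sub
        (ordInftyAtLeast_inv_pow_mul_C _ _ 1)
  refine C_eq_zero_of_ordInftyAtLeast ?_
  have n1 := X_sub_C_ne_zero z₁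
  have n2 := X_sub_C_ne_zero z₂
  -- Multiplying f = a/(z - z₁) + b/(z - z₂) by z - z₁ isolates a + b as a constant. The double zero
  -- of f at infinity makes the right-hand side vanish there.
  have : RatFunc.C (a + b) = (RatFunc.X - RatFunc.C z₁) * f -
      ((RatFunc.X - RatFunc.C z₂) ^ 1)⁻¹ * RatFunc.C ((z₂ - z₁) * b) := by
    rw [sub_sub, sub_eq_zero] at hfe
    rw [hfe]
    simp only [map_add, map_mul, map_sub]
    field_simp
    ring
  rw [this]
  exact ((ordInftyAtLeast_X_sub_C z₁).mul hi (by omega)).sub (ordInftyAtLeast_inv_pow_mul_C _ _ 1)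

/-- The residue theorem for rational forms with at most two poles. -/
theorem residue_add_residue_eq_zero {z₁ z₂ : ℂ} (hz : z₁ ≠ z₂) {f : RatFunc ℂ}
    (hf : ∀ c, c ≠ z₁ → c ≠ z₂ → OrdAtLeast c 0 f) (hi : OrdInftyAtLeast 2 f) :
    coeffAt z₁ (-1) f + coeffAt z₂ (-1) f = 0 := by
  obtain ⟨N, hN⟩ := exists_ordAtLeast z₂ f
  -- The pole at z₁ is made simple first, whatever the pole at z₂; the same reduction with the two
  -- points exchanged then treats z₂.
  refine residue_add_residue_eq_zero_of_reduce hz (m := -N) (by omega) (fun f hf hi _ h1 => ?_)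
    f hf hi hN
  rw [add_comm]
  refine residue_add_residue_eq_zero_of_reduce hz.symm (m := -1) (by omega)
    (fun f hf hi h1 h2 => ?_) f (fun c h1 h2 => hf c h2 h1) hi h1
  rw [add_comm]
  exact residue_add_residue_eq_zero_of_simple hz f (fun c h1 h2 => hf c h2 h1) hi h1 h2

/-- A rational function with poles only at `z₁`, `z₂` and infinity is the sum of a polynomial and
of a function that is regular at infinity. -/
theorem exists_eq_algebraMap_sub {z₁ z₂ : ℂ} {f : RatFunc ℂ}
    (hf : ∀ c, c ≠ z₁ → c ≠ z₂ → OrdAtLeast c 0 f) :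
    ∃ (p : Polynomial ℂ) (b : RatFunc ℂ), OrdInftyAtLeast 0 b ∧ f = algebraMap _ _ p - b := by
  obtain ⟨k, hk⟩ := exists_ordAtLeast z₁ f
  obtain ⟨l, hl⟩ := exists_ordAtLeast z₂ f
  have ht (c d : ℂ) (j : ℕ) : OrdAtLeast c 0 ((RatFunc.X - RatFunc.C d) ^ j) := by
    have h1 : (RatFunc.X - RatFunc.C d : RatFunc ℂ) ^ j =
        algebraMap _ _ ((Polynomial.X - Polynomial.C d : Polynomial ℂ) ^ j) := by
      simp only [map_pow, map_sub, RatFunc.algebraMap_X, RatFunc.algebraMap_C]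
    rw [h1]
    exact ordAtLeast_algebraMap c _
  -- Multiplying by high enough powers of z - z₁ and z - z₂ clears all finite poles and leaves a
  -- polynomial.
  obtain ⟨p, hp⟩ := eq_algebraMap_of_ordAtLeast
    (f := (RatFunc.X - RatFunc.C z₁) ^ k * ((RatFunc.X - RatFunc.C z₂) ^ l * f)) fun c => by
      by_cases hc1 : c = z₁
      · subst hc1
        exact ordAtLeast_pow_mul_iff.2 ((ht _ _ _).mul hk (by omega))
      by_cases hc2 : c = z₂
      · subst hc2
        exact (ht _ _ _).mul (ordAtLeast_pow_mul_iff.2 (by simpa using hl)) (add_zero _)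
      · exact (ht _ _ _).mul ((ht _ _ _).mul (hf c hc1 hc2) (add_zero _)) (add_zero _)
  set q : Polynomial ℂ :=
    (Polynomial.X - Polynomial.C z₁) ^ k * (Polynomial.X - Polynomial.C z₂) ^ l
    with hq
  have hqm : q.Monic :=
    ((Polynomial.monic_X_sub_C z₁).pow k).mul ((Polynomial.monic_X_sub_C z₂).pow l)
  have hq0 : algebraMap (Polynomial ℂ) (RatFunc ℂ) q ≠ 0 := RatFunc.algebraMap_ne_zero hqm.ne_zero
  have hfq : f = algebraMap _ _ p / algebraMap _ _ q := by
    rw [eq_div_iff hq0, ← hp, hq]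
    simp
    ring
  -- Division with remainder by the monic denominator: the quotient is the polynomial part, and
  -- remainder over q is regular at infinity.
  refine ⟨p /ₘ q, -(algebraMap _ _ (p %ₘ q) / algebraMap _ _ q), OrdInftyAtLeast.neg ?_, ?_⟩
  · by_cases hr : p %ₘ q = 0
    · simp [hr, ordInftyAtLeast_zero]
    · right
      rw [RatFunc.intDegree_div (RatFunc.algebraMap_ne_zero hr) hq0, RatFunc.intDegree_polynomial,
        RatFunc.intDegree_polynomial]
      have := Polynomial.natDegree_le_natDegree (Polynomial.degree_modByMonic_lt p hqm).le
      omega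
  · rw [hfq, sub_neg_eq_add]
    nth_rw 1 [← Polynomial.modByMonic_add_div p q]
    rw [map_add, map_mul]
    field_simp
    ring

/-! ### Expansions of matrices -/

section Matrices

variable {n : ℕ}

theorem matCoeff_add (c : ℂ) (k : ℤ) (A B : RMat n) :
    matCoeff c k (A + B) = matCoeff c k A + matCoeff c k B := by
  ext i j
  exact coeffAt_add _ _ _ _

theorem matCoeff_sub (c : ℂ) (k : ℤ) (A B : RMat n) :
    matCoeff c k (A - B) = matCoeff c k A - matCoeff c k B := by
  ext i j
  exact coeffAt_sub _ _ _ _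

theorem matCoeff_map_C (c : ℂ) (k : ℤ) (A : Mat n) :
    matCoeff c k (A.map RatFunc.C) = if k = 0 then A else 0 := by
  ext i j
  simp only [matCoeff, Matrix.of_apply, Matrix.map_apply, coeffAt_C]
  split_ifs <;> rfl

theorem MatOrdAtLeast.add {c : ℂ} {m : ℤ} {A B : RMat n} (hA : MatOrdAtLeast c m A)
    (hB : MatOrdAtLeast c m B) : MatOrdAtLeast c m (A + B) := fun i j => (hA i j).add (hB i j)

theorem MatOrdAtLeast.sub {c : ℂ} {m : ℤ} {A B : RMat n} (hA : MatOrdAtLeast c m A)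
    (hB : MatOrdAtLeast c m B) : MatOrdAtLeast c m (A - B) := fun i j => (hA i j).sub (hB i j)

theorem MatOrdAtLeast.mul {c : ℂ} {l m k : ℤ} {A B : RMat n} (hA : MatOrdAtLeast c l A)
    (hB : MatOrdAtLeast c m B) (hk : l + m = k) : MatOrdAtLeast c k (A * B) := fun i j => by
  rw [Matrix.mul_apply]
  exact ordAtLeast_sum fun x _ => (hA i x).mul (hB x j) hk

theorem MatOrdAtLeast.succ {c : ℂ} {m l : ℤ} {A : RMat n} (h : MatOrdAtLeast c m A)
    (h0 : matCoeff c m A = 0) (hl : l = m + 1) : MatOrdAtLeast c l A := fun i j =>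
  (h i j).succ (congrFun (congrFun h0 i) j) hl

theorem matCoeff_mul {c : ℂ} {l m k : ℤ} {A B : RMat n} (hA : MatOrdAtLeast c l A)
    (hB : MatOrdAtLeast c m B) (hk : l + m = k) :
    matCoeff c k (A * B) = matCoeff c l A * matCoeff c m B := by
  ext i j
  simp only [matCoeff, Matrix.of_apply, Matrix.mul_apply, coeffAt_sum,
    coeffAt_mul (hA _ _) (hB _ _) hk]

theorem matCoeff_mul_succ {c : ℂ} {l m k : ℤ} {A B : RMat n} (hA : MatOrdAtLeast c l A)
    (hB : MatOrdAtLeast c m B) (hk : l + m + 1 = k) :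
    matCoeff c k (A * B) =
      matCoeff c l A * matCoeff c (m + 1) B + matCoeff c (l + 1) A * matCoeff c m B := by
  ext i j
  simp only [matCoeff, Matrix.of_apply, Matrix.mul_apply, Matrix.add_apply, coeffAt_sum,
    coeffAt_mul_succ (hA _ _) (hB _ _) hk, Finset.sum_add_distrib]

theorem coeffAt_trace (c : ℂ) (k : ℤ) (A : RMat n) :
    coeffAt c k A.trace = (matCoeff c k A).trace := by
  simp [Matrix.trace, coeffAt_sum, matCoeff]

theorem ordAtLeast_trace {c : ℂ} {m : ℤ} {A : RMat n} (h : MatOrdAtLeast c m A) :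
    OrdAtLeast c m A.trace := ordAtLeast_sum fun i _ => h i i

theorem matOrdAtLeast_map_C (c : ℂ) (A : Mat n) : MatOrdAtLeast c 0 (A.map RatFunc.C) :=
  fun _ _ => ordAtLeast_C _ _

theorem matOrdInftyAtLeast_map_C (A : Mat n) : MatOrdInftyAtLeast 0 (A.map RatFunc.C) :=
  fun _ _ => ordInftyAtLeast_C _

theorem MatOrdInftyAtLeast.mono {m l : ℤ} {A : RMat n} (h : MatOrdInftyAtLeast m A) (hl : l ≤ m) :
    MatOrdInftyAtLeast l A := fun i j => (h i j).mono hl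

theorem MatOrdInftyAtLeast.sub {m : ℤ} {A B : RMat n} (hA : MatOrdInftyAtLeast m A)
    (hB : MatOrdInftyAtLeast m B) : MatOrdInftyAtLeast m (A - B) :=
  fun i j => (hA i j).sub (hB i j)

theorem MatOrdInftyAtLeast.mul {l m k : ℤ} {A B : RMat n} (hA : MatOrdInftyAtLeast l A)
    (hB : MatOrdInftyAtLeast m B) (hk : l + m = k) : MatOrdInftyAtLeast k (A * B) := fun i j => by
  rw [Matrix.mul_apply]
  exact ordInftyAtLeast_sum fun x _ => (hA i x).mul (hB x j) hk

theorem eq_map_C_of_matOrdAtLeast {A : RMat n} (h : ∀ c, MatOrdAtLeast c 0 A)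
    (h' : MatOrdInftyAtLeast 0 A) : ∃ a : Mat n, A = a.map RatFunc.C := by
  choose a ha using fun i j => eq_C_of_ordAtLeast (fun c => h c i j) (h' i j)
  exact ⟨Matrix.of a, by ext i j; exact ha i j⟩

theorem coeffAt_mulVec {c : ℂ} {l m k : ℤ} {A : RMat n} {s : Fin n → RatFunc ℂ}
    (hA : MatOrdAtLeast c l A) (hs : ∀ i, OrdAtLeast c m (s i)) (hk : l + m = k) :
    (fun i => coeffAt c k ((A *ᵥ s) i)) = matCoeff c l A *ᵥ (fun i => coeffAt c m (s i)) := by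
  ext i
  simp only [matCoeff, Matrix.of_apply, Matrix.mulVec, dotProduct, coeffAt_sum,
    coeffAt_mul (hA _ _) (hs _) hk]

theorem coeffAt_mulVec_succ {c : ℂ} {l m k : ℤ} {A : RMat n} {s : Fin n → RatFunc ℂ}
    (hA : MatOrdAtLeast c l A) (hs : ∀ i, OrdAtLeast c m (s i)) (hk : l + m + 1 = k) :
    (fun i => coeffAt c k ((A *ᵥ s) i)) =
      matCoeff c l A *ᵥ (fun i => coeffAt c (m + 1) (s i)) +
        matCoeff c (l + 1) A *ᵥ (fun i => coeffAt c m (s i)) := by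
  ext i
  simp only [matCoeff, Matrix.of_apply, Matrix.mulVec, dotProduct, coeffAt_sum, Pi.add_apply,
    coeffAt_mul_succ (hA _ _) (hs _) hk, Finset.sum_add_distrib]

end Matrices

variable {n : ℕ} {z₁ z₂ : ℂ}

/-! ### Homomorphisms of bundles at the cusp -/

theorem coeffAt_pow_self (c : ℂ) (m : ℕ) (k : ℤ) :
    coeffAt c k ((RatFunc.X - RatFunc.C c) ^ m) = if k = m then 1 else 0 := by
  have := coeffAt_pow_mul c m k (RatFunc.C 1)
  rw [map_one, mul_one] at this
  rw [this, ← map_one RatFunc.C, coeffAt_C]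
  simp only [sub_eq_zero]

theorem ordAtLeast_pow_self (c : ℂ) (m : ℕ) :
    OrdAtLeast c m ((RatFunc.X - RatFunc.C c) ^ m) := fun k hk => by
  rw [coeffAt_pow_self, if_neg hk.ne]

/-- Value and derivative at the cusp both vanish, so the gluing condition is 0 = L 0. These test
sections serve to bound poles. -/
theorem inBundle_single_pow (L : Mat n) (j : Fin n) {m : ℕ} (hm : 2 ≤ m) :
    InBundle z₁ L (Pi.single j ((RatFunc.X - RatFunc.C z₁) ^ m)) := by
  have h (k : ℤ) (hk : k < 2) (i : Fin n) :
      coeffAt z₁ k (Pi.single (M := fun _ => RatFunc ℂ) j ((RatFunc.X - RatFunc.C z₁) ^ m) i)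
        = 0 := by
    by_cases hij : i = j
    · subst hij
      rw [Pi.single_eq_same]
      exact ordAtLeast_pow_self z₁ m k (by omega)
    · rw [Pi.single_eq_of_ne hij, coeffAt_zero]
  refine ⟨fun i k hk => h k (by omega) i, ?_⟩
  simp only [h 0 (by omega), h 1 (by omega)]
  exact (Matrix.mulVec_zero L).symm

/-- The section of `M_L` with value `v` at the cusp and affine linear in `z`. -/
noncomputable def linearSection (z₁ : ℂ) (L : Mat n) (v : Fin n → ℂ) (i : Fin n) : RatFunc ℂ :=
  RatFunc.C (v i) + (RatFunc.X - RatFunc.C z₁) ^ 1 * RatFunc.C ((L *ᵥ v) i)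

theorem coeffAt_zero_linearSection (L : Mat n) (v : Fin n → ℂ) :
    (fun i => coeffAt z₁ 0 (linearSection z₁ L v i)) = v := by
  ext i
  rw [linearSection, coeffAt_add, coeffAt_pow_mul, coeffAt_C, coeffAt_C]
  simp

theorem coeffAt_one_linearSection (L : Mat n) (v : Fin n → ℂ) :
    (fun i => coeffAt z₁ 1 (linearSection z₁ L v i)) = L *ᵥ v := by
  ext i
  rw [linearSection, coeffAt_add, coeffAt_pow_mul, coeffAt_C, coeffAt_C]
  simp

theorem inBundle_linearSection (L : Mat n) (v : Fin n → ℂ) :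
    InBundle z₁ L (linearSection z₁ L v) := by
  refine ⟨fun i => (ordAtLeast_C _ _).add (ordAtLeast_pow_mul_iff.2
    ((ordAtLeast_C _ _).mono (by omega))), ?_⟩
  rw [coeffAt_zero_linearSection, coeffAt_one_linearSection]

/-- Matrices which map `M_L` to a space of regular sections `s'` with
`s' (z₁)' = L' s' (z₁) + M s (z₁)`. -/
theorem forall_inBundle_mulVec_iff (L L' M : Mat n) (T : RMat n) :
    (∀ s, InBundle z₁ L s → (∀ i, OrdAtLeast z₁ 0 ((T *ᵥ s) i)) ∧
      (fun i => coeffAt z₁ 1 ((T *ᵥ s) i)) = L' *ᵥ (fun i => coeffAt z₁ 0 ((T *ᵥ s) i)) +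
        M *ᵥ (fun i => coeffAt z₁ 0 (s i))) ↔
      MatOrdAtLeast z₁ 0 T ∧
        matCoeff z₁ 1 T + matCoeff z₁ 0 T * L = L' * matCoeff z₁ 0 T + M := by
  constructor
  · intro h
    have hT (j : Fin n) (m : ℕ) : T *ᵥ Pi.single j ((RatFunc.X - RatFunc.C z₁) ^ m) =
        fun i => (RatFunc.X - RatFunc.C z₁) ^ m * T i j := by
      ext i
      simp [Matrix.mulVec_single, mul_comm]
    have hv (j : Fin n) (m : ℕ) (hm : 2 ≤ m) (k : ℤ) (hk : k < 2) :
        (fun i => coeffAt z₁ k (Pi.single (M := fun _ => RatFunc ℂ) j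
          ((RatFunc.X - RatFunc.C z₁) ^ m) i)) = 0 := by
      ext i
      by_cases hij : i = j
      · subst hij
        rw [Pi.single_eq_same]
        exact ordAtLeast_pow_self z₁ m k (by omega)
      · rw [Pi.single_eq_of_ne hij, coeffAt_zero, Pi.zero_apply]
    -- Testing on (z - z₁)² e_j bounds the pole by order 2. In the next two steps (z - z₁)³ e_j and
    -- then (z - z₁)² e_j are mapped to sections with zero value at the cusp, so their derivatives
    -- vanish; these derivatives are the coefficients of T of index -2 and -1.
    have hT2 : MatOrdAtLeast z₁ (-2) T := fun i j => by
      have := (h _ (inBundle_single_pow L j le_rfl)).1 i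
      rw [hT] at this
      exact ordAtLeast_pow_mul_iff.1 this
    have hT1 : MatOrdAtLeast z₁ (-1) T := hT2.succ (by
      ext i j
      have := (h _ (inBundle_single_pow L j (m := 3) (by omega))).2
      rw [hT, hv _ _ (by omega) _ (by omega), Matrix.mulVec_zero, add_zero] at this
      simp only [coeffAt_pow_mul] at this
      rw [show (fun i => coeffAt z₁ (0 - (3 : ℕ)) (T i j)) = 0 from
        funext fun i => hT2 i j _ (by norm_num), Matrix.mulVec_zero] at this
      exact congrFun this i) (by omega)
    have hT0 : MatOrdAtLeast z₁ 0 T := hT1.succ (by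
      ext i j
      have := (h _ (inBundle_single_pow L j (m := 2) (by omega))).2
      rw [hT, hv _ _ (by omega) _ (by omega), Matrix.mulVec_zero, add_zero] at this
      simp only [coeffAt_pow_mul] at this
      rw [show (fun i => coeffAt z₁ (0 - (2 : ℕ)) (T i j)) = 0 from
        funext fun i => hT1 i j _ (by norm_num), Matrix.mulVec_zero] at this
      exact congrFun this i) (by omega)
    refine ⟨hT0, Matrix.ext_of_mulVec_single fun j => ?_⟩
    -- With T regular, the section with value e_j and derivative L e_j yields column j of the
    -- relation.
    set v : Fin n → ℂ := Pi.single j 1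
    have hs := inBundle_linearSection (z₁ := z₁) L v
    have := (h _ hs).2
    rw [coeffAt_mulVec_succ hT0 hs.1 (k := 1) (by omega), coeffAt_mulVec hT0 hs.1 (add_zero 0),
      coeffAt_zero_linearSection, zero_add, coeffAt_one_linearSection] at this
    rw [Matrix.add_mulVec, Matrix.add_mulVec, ← Matrix.mulVec_mulVec, ← Matrix.mulVec_mulVec,
      ← this, add_comm]
  · rintro ⟨hT, h⟩ s ⟨hs, hsL⟩
    constructor
    · intro i
      rw [Matrix.mulVec, dotProduct]
      exact ordAtLeast_sum fun j _ => (hT i j).mul (hs j) (add_zero 0)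
    · rw [coeffAt_mulVec_succ hT hs (k := 1) (by omega), coeffAt_mulVec hT hs (add_zero 0),
        zero_add, hsL, Matrix.mulVec_mulVec, Matrix.mulVec_mulVec, ← Matrix.add_mulVec,
        ← Matrix.add_mulVec, ← h, add_comm]

/-- The case L' = L, M = 0: the endomorphism sheaf is glued at the cusp by the commutator with L,
just as the bundle is glued by L. -/
theorem isLocalEnd_iff {L : Mat n} {T : RMat n} :
    IsLocalEnd z₁ L T ↔ MatOrdAtLeast z₁ 0 T ∧
      matCoeff z₁ 1 T = L * matCoeff z₁ 0 T - matCoeff z₁ 0 T * L := by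
  have := forall_inBundle_mulVec_iff (z₁ := z₁) L L 0 T
  simp only [Matrix.zero_mulVec, add_zero] at this
  rw [eq_sub_iff_add_eq, ← this]
  rfl

/-! ### Higgs fields -/

/-- Every power (z - z₁)^m with m ≠ 1 is a local function. Testing with m = 0 kills the residue, and
with m ≥ 2 the poles of order above 2; the missing m = 1 is what permits a double pole. -/
theorem IsLocalDualizing.ord {α : RatFunc ℂ} (h : IsLocalDualizing z₁ α) :
    OrdAtLeast z₁ (-2) α ∧ coeffAt z₁ (-1) α = 0 := by
  have key (m : ℕ) (hm : m ≠ 1) : coeffAt z₁ (-1 - m) α = 0 := by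
    rw [← coeffAt_pow_mul]
    refine h _ ⟨(ordAtLeast_pow_self z₁ m).mono (by omega), ?_⟩
    rw [coeffAt_pow_self, if_neg (by omega)]
  refine ⟨fun k hk => ?_, by simpa using key 0 (by omega)⟩
  have := key (-1 - k).toNat (by omega)
  rwa [show -1 - ((-1 - k).toNat : ℤ) = k by omega] at this

theorem matCoeff_smul {c : ℂ} {l m k : ℤ} {f : RatFunc ℂ} {A : RMat n} (hf : OrdAtLeast c l f)
    (hA : MatOrdAtLeast c m A) (hk : l + m = k) :
    matCoeff c k (f • A) = coeffAt c l f • matCoeff c m A := by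
  ext i j
  simp [matCoeff, coeffAt_mul hf (hA i j) hk]

theorem matCoeff_smul_succ {c : ℂ} {l m k : ℤ} {f : RatFunc ℂ} {A : RMat n}
    (hf : OrdAtLeast c l f) (hA : MatOrdAtLeast c m A) (hk : l + m + 1 = k) :
    matCoeff c k (f • A) =
      coeffAt c l f • matCoeff c (m + 1) A + coeffAt c (l + 1) f • matCoeff c m A := by
  ext i j
  simp [matCoeff, coeffAt_mul_succ hf (hA i j) hk]

/-- A local dualizing form has at most a double pole and no residue, so the product with an
endomorphism inherits its jet relation two places lower. Conversely F = (z - z₁)⁻² · ((z - z₁)² F)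
displays such a product, a single tensor. -/
theorem mem_localEndDualizing_iff {L : Mat n} {F : RMat n} :
    F ∈ localEndDualizing z₁ L ↔ MatOrdAtLeast z₁ (-2) F ∧
      matCoeff z₁ (-1) F = L * matCoeff z₁ (-2) F - matCoeff z₁ (-2) F * L := by
  constructor
  · intro h
    induction h using Submodule.span_induction with
    | mem S hS =>
      obtain ⟨α, T, hα, hT, rfl⟩ := hS
      obtain ⟨h2, h1⟩ := hα.ord
      obtain ⟨hT0, hT1⟩ := isLocalEnd_iff.1 hT
      refine ⟨fun i j => h2.mul (hT0 i j) (add_zero _), ?_⟩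
      rw [matCoeff_smul_succ h2 hT0 (by omega), matCoeff_smul h2 hT0 (add_zero _), zero_add, hT1,
        show (-2 : ℤ) + 1 = -1 by omega, h1]
      simp [smul_sub]
    | zero =>
      have : ∀ k, matCoeff z₁ k (0 : RMat n) = 0 := fun k => by
        ext i j
        exact coeffAt_zero _ _
      exact ⟨fun i j => ordAtLeast_zero _ _, by simp [this]⟩
    | add S S' _ _ h h' =>
      refine ⟨h.1.add h'.1, ?_⟩
      rw [matCoeff_add, matCoeff_add, h.2, h'.2]
      noncomm_ring
    | smul a S _ h =>
      have hs : a • S = RatFunc.C a • S := by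
        ext i j
        simp [RatFunc.smul_eq_C_mul]
      rw [hs]
      refine ⟨fun i j => (ordAtLeast_C _ a).mul (h.1 i j) (zero_add _), ?_⟩
      rw [matCoeff_smul (ordAtLeast_C _ a) h.1 (zero_add _),
        matCoeff_smul_succ (ordAtLeast_C _ a) h.1 (by omega), coeffAt_C, coeffAt_C]
      simp [h.2, smul_sub]
  · rintro ⟨h2, h1⟩
    set t := (RatFunc.X - RatFunc.C z₁ : RatFunc ℂ)
    refine Submodule.subset_span ⟨(t ^ 2)⁻¹, t ^ 2 • F, fun f hf => ?_,
      isLocalEnd_iff.2 ⟨?_, ?_⟩, ?_⟩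
    · rw [mul_comm, coeffAt_inv_pow_mul]
      exact hf.2
    · exact fun i j => ordAtLeast_pow_mul_iff.2 ((h2 i j).mono (by omega))
    · have (k : ℤ) : matCoeff z₁ k (t ^ 2 • F) = matCoeff z₁ (k - 2) F := by
        ext i j
        simp [matCoeff, t, coeffAt_pow_mul]
      rw [this, this]
      exact h1
    · rw [inv_smul_smul₀ (pow_ne_zero 2 (X_sub_C_ne_zero z₁))]

theorem laxForm_apply (A B C : Mat n) (i j : Fin n) : laxForm z₁ z₂ A B C i j =
    ((RatFunc.X - RatFunc.C z₁) ^ 2)⁻¹ * RatFunc.C (A i j) +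
    ((RatFunc.X - RatFunc.C z₁) ^ 1)⁻¹ * RatFunc.C (B i j) +
    ((RatFunc.X - RatFunc.C z₂) ^ 1)⁻¹ * RatFunc.C (C i j) := by
  simp [laxForm]

theorem matOrdAtLeast_laxForm_of_ne (A B C : Mat n) {c : ℂ} (h1 : c ≠ z₁) (h2 : c ≠ z₂) :
    MatOrdAtLeast c 0 (laxForm z₁ z₂ A B C) := fun i j => by
  rw [laxForm_apply]
  exact (((ordAtLeast_C _ _).inv_pow_mul_of_ne h1 _).add
    ((ordAtLeast_C _ _).inv_pow_mul_of_ne h1 _)).add ((ordAtLeast_C _ _).inv_pow_mul_of_ne h2 _)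

theorem matOrdAtLeast_laxForm_left (hz : z₁ ≠ z₂) (A B C : Mat n) :
    MatOrdAtLeast z₁ (-2) (laxForm z₁ z₂ A B C) := fun i j => by
  rw [laxForm_apply]
  exact ((ordAtLeast_inv_pow_mul_C _ _ _).add ((ordAtLeast_inv_pow_mul_C _ _ _).mono
    (by norm_num))).add (((ordAtLeast_C _ _).inv_pow_mul_of_ne hz _).mono (by omega))

theorem matOrdAtLeast_laxForm_right (hz : z₁ ≠ z₂) (A B C : Mat n) :
    MatOrdAtLeast z₂ (-1) (laxForm z₁ z₂ A B C) := fun i j => by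
  rw [laxForm_apply]
  exact ((((ordAtLeast_C _ _).inv_pow_mul_of_ne hz.symm _).mono (by omega)).add
    (((ordAtLeast_C _ _).inv_pow_mul_of_ne hz.symm _).mono (by omega))).add
      ((ordAtLeast_inv_pow_mul_C _ _ _).mono (by norm_num))

theorem matCoeff_laxForm_left (hz : z₁ ≠ z₂) (A B C : Mat n) :
    matCoeff z₁ (-2) (laxForm z₁ z₂ A B C) = A ∧ matCoeff z₁ (-1) (laxForm z₁ z₂ A B C) = B := by
  constructor <;> ext i j
  · rw [matCoeff, Matrix.of_apply, laxForm_apply, coeffAt_add, coeffAt_add,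
      coeffAt_inv_pow_mul_C, coeffAt_inv_pow_mul_C,
      (ordAtLeast_C z₁ (C i j)).inv_pow_mul_of_ne hz 1 (-2) (by omega)]
    simp
  · rw [matCoeff, Matrix.of_apply, laxForm_apply, coeffAt_add, coeffAt_add,
      coeffAt_inv_pow_mul_C, coeffAt_inv_pow_mul_C,
      (ordAtLeast_C z₁ (C i j)).inv_pow_mul_of_ne hz 1 (-1) (by omega)]
    simp

theorem matCoeff_laxForm_right (hz : z₁ ≠ z₂) (A B C : Mat n) :
    matCoeff z₂ (-1) (laxForm z₁ z₂ A B C) = C := by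
  ext i j
  rw [matCoeff, Matrix.of_apply, laxForm_apply, coeffAt_add, coeffAt_add,
    coeffAt_inv_pow_mul_C, (ordAtLeast_C z₂ _).inv_pow_mul_of_ne hz.symm 2 (-1) (by omega),
    (ordAtLeast_C z₂ _).inv_pow_mul_of_ne hz.symm 1 (-1) (by omega)]
  simp

theorem matOrdInftyAtLeast_laxForm (A B C : Mat n) :
    MatOrdInftyAtLeast 1 (laxForm z₁ z₂ A B C) := fun i j => by
  rw [laxForm_apply]
  exact (((ordInftyAtLeast_inv_pow_mul_C _ _ 2).mono (by norm_num)).add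
    (ordInftyAtLeast_inv_pow_mul_C _ _ 1)).add (ordInftyAtLeast_inv_pow_mul_C _ _ 1)

theorem laxForm_injective (hz : z₁ ≠ z₂) {A B C A' B' C' : Mat n}
    (h : laxForm z₁ z₂ A B C = laxForm z₁ z₂ A' B' C') : A = A' ∧ B = B' ∧ C = C' := by
  have h1 := matCoeff_laxForm_left hz A B C
  have h2 := matCoeff_laxForm_right hz A B C
  rw [h, (matCoeff_laxForm_left hz A' B' C').1, (matCoeff_laxForm_left hz A' B' C').2] at h1
  rw [h, matCoeff_laxForm_right hz] at h2
  exact ⟨h1.1.symm, h1.2.symm, h2.symm⟩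

/-- Subtracting all principal parts leaves a matrix regular everywhere and zero at infinity, hence
zero. -/
theorem eq_laxForm (hz : z₁ ≠ z₂) {F : RMat n} (h : ∀ c, c ≠ z₁ → c ≠ z₂ → MatOrdAtLeast c 0 F)
    (hi : MatOrdInftyAtLeast 1 F) (h1 : MatOrdAtLeast z₁ (-2) F) (h2 : MatOrdAtLeast z₂ (-1) F) :
    F = laxForm z₁ z₂ (matCoeff z₁ (-2) F) (matCoeff z₁ (-1) F) (matCoeff z₂ (-1) F) := by
  rw [← sub_eq_zero]
  set G := laxForm z₁ z₂ (matCoeff z₁ (-2) F) (matCoeff z₁ (-1) F) (matCoeff z₂ (-1) F) with hG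
  have hreg : ∀ c, MatOrdAtLeast c 0 (F - G) := fun c => by
    by_cases hc1 : c = z₁
    · subst hc1
      refine MatOrdAtLeast.succ (m := -1) (MatOrdAtLeast.succ (m := -2)
        (h1.sub (matOrdAtLeast_laxForm_left hz _ _ _)) ?_ (by omega)) ?_ (by omega)
      · rw [matCoeff_sub, hG, (matCoeff_laxForm_left hz _ _ _).1, sub_self]
      · rw [matCoeff_sub, hG, (matCoeff_laxForm_left hz _ _ _).2, sub_self]
    by_cases hc2 : c = z₂
    · subst hc2
      refine MatOrdAtLeast.succ (m := -1)
        (h2.sub (matOrdAtLeast_laxForm_right hz _ _ _)) ?_ (by omega)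
      rw [matCoeff_sub, hG, matCoeff_laxForm_right hz, sub_self]
    · exact (h c hc1 hc2).sub (matOrdAtLeast_laxForm_of_ne _ _ _ hc1 hc2)
  ext i j
  exact eq_zero_of_ordAtLeast (fun c => hreg c i j)
    ((hi.sub (matOrdInftyAtLeast_laxForm _ _ _)) i j)

/-- Opposite residues combine to B (z₁ - z₂) / ((z - z₁)(z - z₂)), which gains one order of
vanishing at infinity. -/
theorem matOrdInftyAtLeast_two_laxForm (A B : Mat n) :
    MatOrdInftyAtLeast 2 (laxForm z₁ z₂ A B (-B)) := fun i j => by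
  have n1 := X_sub_C_ne_zero z₁
  have n2 := X_sub_C_ne_zero z₂
  have : laxForm z₁ z₂ A B (-B) i j = ((RatFunc.X - RatFunc.C z₁) ^ 2)⁻¹ * RatFunc.C (A i j) +
      (((RatFunc.X - RatFunc.C z₁) ^ 1)⁻¹ * RatFunc.C (B i j)) *
        (((RatFunc.X - RatFunc.C z₂) ^ 1)⁻¹ * RatFunc.C (z₁ - z₂)) := by
    rw [laxForm_apply, Matrix.neg_apply, map_neg, map_sub]
    field_simp
    ring
  rw [this]
  exact (ordInftyAtLeast_inv_pow_mul_C _ _ 2).add ((ordInftyAtLeast_inv_pow_mul_C _ _ 1).mul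
    (ordInftyAtLeast_inv_pow_mul_C _ _ 1) (by norm_num))

theorem isHiggs_laxForm (hz : z₁ ≠ z₂) (L A : Mat n) :
    IsHiggs z₁ z₂ L (laxForm z₁ z₂ A (L * A - A * L) (-(L * A - A * L))) := by
  refine ⟨fun c => matOrdAtLeast_laxForm_of_ne _ _ _, matOrdInftyAtLeast_two_laxForm _ _,
    matOrdAtLeast_laxForm_right hz _ _ _,
    mem_localEndDualizing_iff.2 ⟨matOrdAtLeast_laxForm_left hz _ _ _, ?_⟩⟩
  rw [(matCoeff_laxForm_left hz _ _ _).1, (matCoeff_laxForm_left hz _ _ _).2]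

/-- The coefficient at the simple pole in z₁ is forced by the cusp; the residue at z₂ is its
negative by the residue theorem, applied entrywise. -/
theorem IsHiggs.exists_eq (hz : z₁ ≠ z₂) {L : Mat n} {F : RMat n} (h : IsHiggs z₁ z₂ L F) :
    ∃ A : Mat n, F = laxForm z₁ z₂ A (L * A - A * L) (-(L * A - A * L)) := by
  obtain ⟨hr, hi, h2, hd⟩ := h
  obtain ⟨h1, hd⟩ := mem_localEndDualizing_iff.1 hd
  refine ⟨matCoeff z₁ (-2) F, ?_⟩
  rw [← hd]
  have hC : matCoeff z₂ (-1) F = -matCoeff z₁ (-1) F := by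
    ext i j
    exact eq_neg_of_add_eq_zero_right
      (residue_add_residue_eq_zero hz (fun c hc1 hc2 => hr c hc1 hc2 i j) (hi i j))
  rw [← hC]
  exact eq_laxForm hz hr (hi.mono (by omega)) h1 h2

theorem isHiggs_iff_existsUnique (hz : z₁ ≠ z₂) (L : Mat n) (F : RMat n) : IsHiggs z₁ z₂ L F ↔
    ∃! A : Mat n × Mat n × Mat n, F = laxForm z₁ z₂ A.1 A.2.1 A.2.2 ∧
      A.2.1 = L * A.1 - A.1 * L ∧ A.2.2 = -A.2.1 := by
  constructor
  · intro h
    obtain ⟨A, hA⟩ := h.exists_eq hz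
    refine ⟨(A, _, _), ⟨hA, rfl, rfl⟩, ?_⟩
    rintro ⟨A', B', C'⟩ ⟨h', -, -⟩
    obtain ⟨h1, h2, h3⟩ := laxForm_injective hz (h'.symm.trans hA)
    exact Prod.ext h1 (Prod.ext h2 h3)
  · rintro ⟨⟨A, B, C⟩, ⟨rfl, hB, hC⟩, -⟩
    simp only at hB hC
    rw [hC, hB]
    exact isHiggs_laxForm hz L A

/-! ### Isomorphisms of triples -/

theorem map_C_mul_laxForm_mul (g h A B C : Mat n) :
    g.map RatFunc.C * laxForm z₁ z₂ A B C * h.map RatFunc.C =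
      laxForm z₁ z₂ (g * A * h) (g * B * h) (g * C * h) := by
  simp only [laxForm, Matrix.map_mul, mul_add, add_mul, Matrix.mul_smul, Matrix.smul_mul]

theorem phi2_act (g h : GL (Fin n) ℂ) (s : Phase n) :
    phi2 (act g h s) = (g : Mat n) * phi2 s * ((g⁻¹ : GL (Fin n) ℂ) : Mat n) := by
  have hg : ((g⁻¹ : GL (Fin n) ℂ) : Mat n) * (g : Mat n) = 1 := g.inv_mul
  simp only [phi2, act, lam, phi1, mul_sub, sub_mul]
  congr 1 <;> simp only [mul_assoc] <;> rw [← mul_assoc _ (g : Mat n), hg, one_mul]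

theorem higgs_act (g h : GL (Fin n) ℂ) (s : Phase n) : higgs z₁ z₂ (act g h s) =
    (g : Mat n).map RatFunc.C * higgs z₁ z₂ s *
      ((g⁻¹ : GL (Fin n) ℂ) : Mat n).map RatFunc.C := by
  rw [higgs, higgs, map_C_mul_laxForm_mul, phi2_act]
  simp only [mul_neg, neg_mul]
  rfl

theorem forall_inBundle_iff_of_conj (g : GL (Fin n) ℂ) {L L' : Mat n}
    (h : L' = (g : Mat n) * L * ((g⁻¹ : GL (Fin n) ℂ) : Mat n)) (s : Fin n → RatFunc ℂ)
    (hs : InBundle z₁ L s) : InBundle z₁ L' ((g : Mat n).map RatFunc.C *ᵥ s) := by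
  have := (forall_inBundle_mulVec_iff (z₁ := z₁) L L' 0 ((g : Mat n).map RatFunc.C)).2
    ⟨matOrdAtLeast_map_C _ _, by
      rw [matCoeff_map_C, matCoeff_map_C, if_neg one_ne_zero, if_pos rfl, h, zero_add, add_zero,
        mul_assoc, g.inv_mul, mul_one]⟩ s hs
  rwa [Matrix.zero_mulVec, add_zero] at this

/-- Preserving the stalks at the cusp makes K and K⁻¹ regular there too, so both are constant
matrices. A constant has zero derivative, and the cusp condition becomes g Λ = Λ' g; comparing
double poles conjugates Φ₁. -/
theorem tripleIso_iff (hz : z₁ ≠ z₂) (s s' : Phase n) :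
    TripleIso z₁ z₂ (lam s) (frm s) (higgs z₁ z₂ s) (lam s') (frm s') (higgs z₁ z₂ s') ↔
      ∃ g : GL (Fin n) ℂ, s' = act g 1 s := by
  constructor
  · rintro ⟨K, hreg, hi, hi', hB, hU, hF⟩
    have hK1 : MatOrdAtLeast z₁ 0 (K : RMat n) ∧ matCoeff z₁ 1 (K : RMat n) +
        matCoeff z₁ 0 (K : RMat n) * lam s = lam s' * matCoeff z₁ 0 (K : RMat n) + 0 :=
      (forall_inBundle_mulVec_iff _ _ _ _).1 fun v hv => by
        rw [Matrix.zero_mulVec, add_zero]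
        exact (hB v).1 hv
    have hK2 : MatOrdAtLeast z₁ 0 ((K⁻¹ : GL (Fin n) (RatFunc ℂ)) : RMat n) :=
      ((forall_inBundle_mulVec_iff (lam s') (lam s) 0 _).1 fun v hv => by
        rw [Matrix.zero_mulVec, add_zero]
        refine (hB _).2 ?_
        rwa [Matrix.mulVec_mulVec, K.mul_inv, Matrix.one_mulVec]).1
    obtain ⟨a, ha⟩ := eq_map_C_of_matOrdAtLeast (A := (K : RMat n)) (fun c => by
      by_cases hc : c = z₁
      · subst hc; exact hK1.1
      · exact (hreg c hc).1) hi
    obtain ⟨b, hb⟩ := eq_map_C_of_matOrdAtLeast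
      (A := ((K⁻¹ : GL (Fin n) (RatFunc ℂ)) : RMat n)) (fun c => by
      by_cases hc : c = z₁
      · subst hc; exact hK2
      · exact (hreg c hc).2) hi'
    have hab : a * b = 1 := by
      have := K.mul_inv
      rw [ha, hb, ← Matrix.map_mul] at this
      refine Matrix.map_injective RatFunc.C.injective ?_
      simp [this]
    have hba : b * a = 1 := mul_eq_one_comm.1 hab
    let g : GL (Fin n) ℂ := ⟨a, b, hab, hba⟩
    have hg : (g : Mat n) = a := rfl
    have hg' : ((g⁻¹ : GL (Fin n) ℂ) : Mat n) = b := rfl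
    refine ⟨g, ?_⟩
    rw [ha] at hK1 hU hF
    rw [hb] at hF
    simp only [matCoeff_map_C, one_ne_zero, if_false, if_true, zero_add, add_zero] at hK1 hU
    have h1 : lam s' = a * lam s * b := by
      rw [hK1.2, mul_assoc, hab, mul_one]
    rw [← hg, ← hg', ← higgs_act g 1] at hF
    have h2 := (laxForm_injective hz hF).1
    refine Prod.ext ?_ (Prod.ext ?_ ?_)
    · exact h1
    · change frm s' = a * frm s * 1
      rw [mul_one, hU]
    · exact h2.symm
  · rintro ⟨g, rfl⟩
    have hgi : (g : Mat n).map RatFunc.C * ((g⁻¹ : GL (Fin n) ℂ) : Mat n).map RatFunc.C = 1 := by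
      rw [← Matrix.map_mul, g.mul_inv]
      simp
    have hig : ((g⁻¹ : GL (Fin n) ℂ) : Mat n).map RatFunc.C * (g : Mat n).map RatFunc.C = 1 :=
      mul_eq_one_comm.1 hgi
    refine ⟨⟨(g : Mat n).map RatFunc.C, ((g⁻¹ : GL (Fin n) ℂ) : Mat n).map RatFunc.C, hgi, hig⟩,
      fun c _ => ⟨matOrdAtLeast_map_C _ _, matOrdAtLeast_map_C _ _⟩, matOrdInftyAtLeast_map_C _,
      matOrdInftyAtLeast_map_C _, fun v => ⟨forall_inBundle_iff_of_conj g rfl v, fun hv => ?_⟩,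
      ?_, (higgs_act g 1 s).symm⟩
    · have := forall_inBundle_iff_of_conj (z₁ := z₁) g⁻¹ (L := lam (act g 1 s)) (L' := lam s) (by
        change _ = ((g⁻¹ : GL (Fin n) ℂ) : Mat n) * ((g : Mat n) * lam s *
          ((g⁻¹ : GL (Fin n) ℂ) : Mat n)) * ((g⁻¹⁻¹ : GL (Fin n) ℂ) : Mat n)
        rw [inv_inv, mul_assoc, mul_assoc, g.inv_mul, mul_one, ← mul_assoc, g.inv_mul, one_mul])
        _ hv
      rwa [Matrix.mulVec_mulVec, hig, Matrix.one_mulVec] at this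
    · change matCoeff z₂ 0 ((g : Mat n).map RatFunc.C) * frm s = (g : Mat n) * frm s * 1
      rw [matCoeff_map_C, if_pos rfl, mul_one]

/-! ### The first cohomology group -/

/-- The test-section criterion with inhomogeneous term M = L' replaces the first-order deformed
stalk by a relation between the value and derivative of a at z₁. -/
theorem isKodairaSpencer_iff {L U L' U' : Mat n} {χ : RMat n} :
    IsKodairaSpencer z₁ z₂ L U L' U' χ ↔ ∃ a b : RMat n, (∀ c, MatOrdAtLeast c 0 a) ∧
      matCoeff z₁ 1 a = L * matCoeff z₁ 0 a - matCoeff z₁ 0 a * L + L' ∧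
      matCoeff z₂ 0 a * U = U' ∧ IsOuterSection z₁ z₂ b ∧ χ = a - b := by
  refine exists_congr fun a => exists_congr fun b => ?_
  have h := forall_inBundle_mulVec_iff (z₁ := z₁) L L L' a
  constructor
  · rintro ⟨h1, h2, h3, h4⟩
    obtain ⟨h5, h6⟩ := h.1 fun s hs => (h2 s hs).2
    refine ⟨fun c => ?_, ?_, h3, h4⟩
    · by_cases hc : c = z₁
      · subst hc; exact h5
      · exact h1 c hc
    · rw [sub_add_eq_add_sub, ← h6, add_sub_cancel_right]
  · rintro ⟨h1, h2, h3, h4⟩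
    refine ⟨fun c _ => h1 c, fun s hs => ⟨hs, h.2 ⟨h1 z₁, ?_⟩ s hs⟩, h3, h4⟩
    rw [h2]
    abel

theorem isOuterSection_zero : IsOuterSection z₁ z₂ (0 : RMat n) :=
  ⟨fun _ _ _ _ _ => ordAtLeast_zero _ _, fun _ _ => ordInftyAtLeast_zero _⟩

theorem exists_isKodairaSpencer (hz : z₁ ≠ z₂) (L : Mat n) {U : Mat n} (hU : IsUnit U.det)
    (L' U' : Mat n) : ∃ χ, IsKodairaSpencer z₁ z₂ L U L' U' χ := by
  set w := z₂ - z₁ with hw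
  have hw0 : w ≠ 0 := sub_ne_zero.2 hz.symm
  -- The polynomial (z - z₁) L' + (z - z₁)² c has value 0 and derivative L' at z₁; this c gives it
  -- the value U' U⁻¹ at z₂. The outer section can then be zero.
  set c : Mat n := (w ^ 2)⁻¹ • (U' * U⁻¹ - w • L') with hc
  set a : RMat n := Matrix.of fun i j => (RatFunc.X - RatFunc.C z₁) ^ 1 * RatFunc.C (L' i j) +
    (RatFunc.X - RatFunc.C z₁) ^ 2 * RatFunc.C (c i j) with ha
  have hp (i j) : a i j = algebraMap _ _ ((Polynomial.X - Polynomial.C z₁) *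
      Polynomial.C (L' i j) + (Polynomial.X - Polynomial.C z₁) ^ 2 * Polynomial.C (c i j)) := by
    simp [ha]
  have h0 : matCoeff z₁ 0 a = 0 := by
    ext i j
    rw [matCoeff, Matrix.of_apply, hp, coeffAt_zero_algebraMap]
    simp
  refine ⟨a, isKodairaSpencer_iff.2 ⟨a, 0, fun d i j => ?_, ?_, ?_, isOuterSection_zero,
    (sub_zero a).symm⟩⟩
  · rw [hp]
    exact ordAtLeast_algebraMap _ _
  · rw [h0, mul_zero, zero_mul, sub_zero, zero_add]
    ext i j
    rw [matCoeff, Matrix.of_apply, ha, Matrix.of_apply, coeffAt_add, coeffAt_pow_mul,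
      coeffAt_pow_mul, coeffAt_C, coeffAt_C]
    simp
  · have : matCoeff z₂ 0 a = U' * U⁻¹ := by
      have h1 : matCoeff z₂ 0 a = w • L' + w ^ 2 • c := by
        ext i j
        rw [matCoeff, Matrix.of_apply, hp, coeffAt_zero_algebraMap]
        simp [hw]
      rw [h1, hc, smul_inv_smul₀ (pow_ne_zero 2 hw0)]
      abel
    rw [this, mul_assoc, Matrix.nonsing_inv_mul _ hU, mul_one]

/-- The polynomial part of χ is a valid section a for any bundle data: L' is defined as the defect
in the cusp relation, and U' as a(z₂) U. -/
theorem isCochain_iff (L U : Mat n) (χ : RMat n) :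
    IsCochain z₁ z₂ χ ↔ ∃ L' U', IsKodairaSpencer z₁ z₂ L U L' U' χ := by
  constructor
  · intro h
    choose p b hb hχ using fun i j => exists_eq_algebraMap_sub (fun c h1 h2 => h c h1 h2 i j)
    set a : RMat n := Matrix.of fun i j => algebraMap _ _ (p i j) with ha
    have hreg : ∀ c, MatOrdAtLeast c 0 a := fun c i j => ordAtLeast_algebraMap c _
    have hb' : Matrix.of b = a - χ := by
      ext i j
      simp [ha, hχ i j]
    refine ⟨matCoeff z₁ 1 a - (L * matCoeff z₁ 0 a - matCoeff z₁ 0 a * L), matCoeff z₂ 0 a * U,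
      isKodairaSpencer_iff.2 ⟨a, Matrix.of b, hreg, by abel, rfl, ⟨fun c h1 h2 => ?_, hb⟩, ?_⟩⟩
    · rw [hb']
      exact (hreg c).sub (h c h1 h2)
    · rw [hb']
      abel
  · rintro ⟨L', U', h⟩
    obtain ⟨a, b, ha, -, -, hb, rfl⟩ := isKodairaSpencer_iff.1 h
    exact fun c h1 h2 => (ha c).sub (hb.1 c h1 h2)

/-- Two splittings a - b = a' - b' give a - a' = b - b', regular on both charts and hence a constant
ξ. Conversely, subtracting ξ from both a and b turns them into honest sections of the two charts. -/
theorem IsKodairaSpencer.isCoboundary_iff {L U L' U' : Mat n} {χ : RMat n} (hU : IsUnit U.det)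
    (h : IsKodairaSpencer z₁ z₂ L U L' U' χ) :
    IsCoboundary z₁ z₂ L χ ↔ ∃ ξ : Mat n, L' = ξ * L - L * ξ ∧ U' = ξ * U := by
  obtain ⟨a, b, ha, h1, h2, hb, rfl⟩ := isKodairaSpencer_iff.1 h
  constructor
  · rintro ⟨a', b', ⟨ha', hE, h0⟩, hb', he⟩
    obtain ⟨hE0, hE1⟩ := isLocalEnd_iff.1 hE
    have hab : a - a' = b - b' := by
      rw [sub_eq_sub_iff_sub_eq_sub, he]
    have hra' : ∀ c, MatOrdAtLeast c 0 a' := fun c => by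
      by_cases hc : c = z₁
      · subst hc; exact hE0
      · exact ha' c hc
    obtain ⟨ξ, hξ⟩ := eq_map_C_of_matOrdAtLeast (A := a - a') (fun c => (ha c).sub (hra' c))
      (by rw [hab]; exact hb.2.sub hb'.2)
    have hξk (c k) : matCoeff c k a = matCoeff c k a' + matCoeff c k (ξ.map RatFunc.C) := by
      rw [← hξ, matCoeff_sub]
      abel
    refine ⟨ξ, ?_, ?_⟩
    · have : L' = matCoeff z₁ 1 a - (L * matCoeff z₁ 0 a - matCoeff z₁ 0 a * L) := by
        rw [h1]
        abel
      rw [this, hξk, hξk, hE1, matCoeff_map_C, matCoeff_map_C, if_pos rfl, if_neg one_ne_zero]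
      noncomm_ring
    · rw [← h2, hξk, h0, matCoeff_map_C, if_pos rfl, zero_add]
  · rintro ⟨ξ, rfl, rfl⟩
    have hξ (c : ℂ) (k : ℤ) :
        matCoeff c k (a - ξ.map RatFunc.C) = matCoeff c k a - if k = 0 then ξ else 0 := by
      rw [matCoeff_sub, matCoeff_map_C]
    refine ⟨a - ξ.map RatFunc.C, b - ξ.map RatFunc.C,
      ⟨fun c _ => (ha c).sub (matOrdAtLeast_map_C _ _), isLocalEnd_iff.2
        ⟨(ha _).sub (matOrdAtLeast_map_C _ _), ?_⟩, ?_⟩,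
      ⟨fun c h3 h4 => (hb.1 c h3 h4).sub (matOrdAtLeast_map_C _ _),
        hb.2.sub (matOrdInftyAtLeast_map_C _)⟩, (sub_sub_sub_cancel_right _ _ _).symm⟩
    · rw [hξ, hξ, h1, if_pos rfl, if_neg one_ne_zero]
      noncomm_ring
    · rw [hξ, if_pos rfl]
      have : matCoeff z₂ 0 a = ξ := by
        have := congrArg (· * U⁻¹) h2
        simpa [mul_assoc, Matrix.mul_nonsing_inv _ hU] using this
      rw [this, sub_self]

/-! ### Serre's pairing -/

/-- The form Tr(F b) has poles only at z₁ and z₂, so its residues cancel. What remains involves only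
the 1-jet of a at z₁ and its value at z₂. -/
theorem serrePairing_laxForm (hz : z₁ ≠ z₂) {L U L' U' : Mat n} {χ : RMat n} (hU : IsUnit U.det)
    (h : IsKodairaSpencer z₁ z₂ L U L' U' χ) (A : Mat n) :
    serrePairing z₁ z₂ (laxForm z₁ z₂ A (L * A - A * L) (-(L * A - A * L))) χ =
      (A * L').trace - (U⁻¹ * (L * A - A * L) * U').trace := by
  obtain ⟨a, b, ha, h1, h2, hb, rfl⟩ := isKodairaSpencer_iff.1 h
  set B := L * A - A * L with hB
  set F := laxForm z₁ z₂ A B (-B) with hF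
  have hres : coeffAt z₁ (-1) (F * b).trace + coeffAt z₂ (-1) (F * b).trace = 0 := by
    refine residue_add_residue_eq_zero hz (fun c hc1 hc2 => ordAtLeast_trace
      ((matOrdAtLeast_laxForm_of_ne _ _ _ hc1 hc2).mul (hb.1 c hc1 hc2) (add_zero _))) ?_
    exact ordInftyAtLeast_sum fun i _ =>
      ((matOrdInftyAtLeast_two_laxForm A B).mul hb.2 (add_zero _)) i i
  have hl := matOrdAtLeast_laxForm_left hz A B (-B)
  have hr := matOrdAtLeast_laxForm_right hz A B (-B)
  have e1 : coeffAt z₁ (-1) (F * a).trace =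
      (A * matCoeff z₁ 1 a + B * matCoeff z₁ 0 a).trace := by
    have := matCoeff_laxForm_left hz A B (-B)
    rw [coeffAt_trace, hF, matCoeff_mul_succ hl (ha z₁) (by omega), this.1, zero_add,
      show (-2 : ℤ) + 1 = -1 by omega, this.2]
  have e2 : coeffAt z₂ (-1) (F * a).trace = (-B * matCoeff z₂ 0 a).trace := by
    rw [coeffAt_trace, hF, matCoeff_mul hr (ha z₂) (add_zero _), matCoeff_laxForm_right hz]
  have e3 : matCoeff z₂ 0 a = U' * U⁻¹ := by
    rw [← h2, mul_assoc, Matrix.mul_nonsing_inv _ hU, mul_one]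
  have e4 : (U⁻¹ * B * U').trace = (B * (U' * U⁻¹)).trace := by
    rw [mul_assoc, Matrix.trace_mul_comm, mul_assoc]
  -- The unknown value of a at the cusp cancels: Tr(A [L, x]) + Tr([L, A] x) = 0.
  have e5 : (A * matCoeff z₁ 1 a + B * matCoeff z₁ 0 a).trace = (A * L').trace := by
    set x := matCoeff z₁ 0 a
    have : (A * x * L).trace = (L * A * x).trace := by
      rw [Matrix.trace_mul_comm, mul_assoc]
    rw [h1, hB]
    simp only [mul_add, mul_sub, sub_mul, Matrix.trace_add, Matrix.trace_sub, ← mul_assoc, this]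
    ring
  rw [serrePairing, mul_sub, Matrix.trace_sub, coeffAt_sub, coeffAt_sub, e1, e2, e3, e4, e5,
    neg_mul, Matrix.trace_neg]
  linear_combination -hres

theorem trace_mul_left_eq_zero {A : Mat n} (h : ∀ B : Mat n, (B * A).trace = 0) : A = 0 :=
  Matrix.ext_iff_trace_mul_left.2 fun B => by rw [h B, mul_zero, Matrix.trace_zero]

/-- With U = 1 the pairing against the field of leading coefficient A is Tr A (L' - [U', L]). Its
vanishing for all A says that the class is the gauge direction of ξ = U'. -/
theorem isCoboundary_iff_serrePairing_eq_zero (hz : z₁ ≠ z₂) (L : Mat n) {χ : RMat n}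
    (hχ : IsCochain z₁ z₂ χ) :
    IsCoboundary z₁ z₂ L χ ↔ ∀ F, IsHiggs z₁ z₂ L F → serrePairing z₁ z₂ F χ = 0 := by
  have h1 : IsUnit (1 : Mat n).det := by simp
  obtain ⟨L', U', h⟩ := (isCochain_iff L 1 χ).1 hχ
  have key (A ξ : Mat n) : ((L * A - A * L) * ξ).trace = (A * (ξ * L - L * ξ)).trace := by
    have : (L * A * ξ).trace = (A * ξ * L).trace := by rw [mul_assoc, Matrix.trace_mul_comm]
    simp only [mul_sub, sub_mul, Matrix.trace_sub, ← mul_assoc, this]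
  rw [h.isCoboundary_iff h1]
  constructor
  · rintro ⟨ξ, rfl, rfl⟩ F hF
    obtain ⟨A, rfl⟩ := hF.exists_eq hz
    rw [serrePairing_laxForm hz h1 h, inv_one, one_mul, mul_one, key, sub_self]
  · intro hF
    refine ⟨U', ?_, (mul_one _).symm⟩
    rw [← sub_eq_zero]
    refine trace_mul_left_eq_zero fun A => ?_
    have := hF _ (isHiggs_laxForm hz L A)
    rwa [serrePairing_laxForm hz h1 h, inv_one, one_mul, key, ← Matrix.trace_sub, ← mul_sub] at this

theorem IsHiggs.eq_zero_of_serrePairing_eq_zero (hz : z₁ ≠ z₂) {L : Mat n} {F : RMat n}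
    (hF : IsHiggs z₁ z₂ L F) (h : ∀ χ, IsCochain z₁ z₂ χ → serrePairing z₁ z₂ F χ = 0) :
    F = 0 := by
  have h1 : IsUnit (1 : Mat n).det := by simp
  obtain ⟨A, rfl⟩ := hF.exists_eq hz
  have hA : A = 0 := trace_mul_left_eq_zero fun B => by
    obtain ⟨χ, hχ⟩ := exists_isKodairaSpencer hz L h1 B 0
    have := h χ ((isCochain_iff L 1 χ).2 ⟨B, 0, hχ⟩)
    rwa [serrePairing_laxForm hz h1 hχ, mul_zero, Matrix.trace_zero, sub_zero,
      Matrix.trace_mul_comm] at this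
  subst hA
  ext i j
  simp [laxForm]

/-! ### Calculus of matrix-valued functions -/

section Calculus

variable {E : Type*} [NormedAddCommGroup E] [NormedSpace ℂ E]

theorem contDiffOn_matrix_iff {k : WithTop ℕ∞} {A : E → Mat n} {S : Set E} :
    ContDiffOn ℂ k A S ↔ ∀ i j, ContDiffOn ℂ k (fun t => A t i j) S := by
  refine (contDiffOn_pi (𝕜 := ℂ) (Φ := A)).trans (forall_congr' fun i => ?_)
  exact contDiffOn_pi (𝕜 := ℂ) (Φ := fun t => A t i)

/-- The entrywise sup norm is not submultiplicative in general, so smoothness is checked on entries.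
-/
theorem contDiffOn_matrix_mul {k : WithTop ℕ∞} {A B : E → Mat n} {S : Set E}
    (hA : ContDiffOn ℂ k A S) (hB : ContDiffOn ℂ k B S) :
    ContDiffOn ℂ k (fun t => A t * B t) S := by
  rw [contDiffOn_matrix_iff] at *
  intro i j
  simp only [Matrix.mul_apply]
  exact ContDiffOn.sum fun x _ => (hA i x).mul (hB x j)

theorem contDiffOn_matrix_trace {k : WithTop ℕ∞} {A : E → Mat n} {S : Set E}
    (hA : ContDiffOn ℂ k A S) : ContDiffOn ℂ k (fun t => (A t).trace) S := by
  rw [contDiffOn_matrix_iff] at hA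
  exact ContDiffOn.sum fun i _ => hA i i

theorem contDiffOn_matrix_det {k : WithTop ℕ∞} {A : E → Mat n} {S : Set E}
    (hA : ContDiffOn ℂ k A S) : ContDiffOn ℂ k (fun t => (A t).det) S := by
  rw [contDiffOn_matrix_iff] at hA
  simp only [Matrix.det_apply']
  exact ContDiffOn.sum fun σ _ => contDiffOn_const.mul (contDiffOn_prod fun i _ => hA _ _)

theorem contDiffOn_matrix_inv {k : WithTop ℕ∞} {A : E → Mat n} {S : Set E}
    (hA : ContDiffOn ℂ k A S) (h : ∀ t ∈ S, IsUnit (A t).det) :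
    ContDiffOn ℂ k (fun t => (A t)⁻¹) S := by
  rw [contDiffOn_matrix_iff]
  intro i j
  simp only [Matrix.inv_def, Ring.inverse_eq_inv', Matrix.smul_apply, smul_eq_mul,
    Matrix.adjugate_apply]
  refine ((contDiffOn_matrix_det hA).inv fun t ht => (h t ht).ne_zero).mul
    (contDiffOn_matrix_det ?_)
  rw [contDiffOn_matrix_iff] at *
  intro a b
  simp only [Matrix.updateRow_apply]
  split_ifs
  · exact contDiffOn_const
  · exact hA a b

/-- Multiplication of matrices as a continuous bilinear map. -/
noncomputable def mulCLM (n : ℕ) : Mat n →L[ℂ] Mat n →L[ℂ] Mat n :=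
  (LinearMap.mul ℂ (Mat n)).toContinuousBilinearMap

/-- The trace as a continuous linear map. -/
noncomputable def traceCLM (n : ℕ) : Mat n →L[ℂ] ℂ :=
  LinearMap.toContinuousLinearMap (Matrix.traceLinearMap (Fin n) ℂ ℂ)

end Calculus

theorem differentiableAt_matrix_mul {A B : Phase n → Mat n} {s : Phase n}
    (hA : DifferentiableAt ℂ A s) (hB : DifferentiableAt ℂ B s) :
    DifferentiableAt ℂ (fun t => A t * B t) s :=
  ((mulCLM n).hasFDerivAt_of_bilinear hA.hasFDerivAt hB.hasFDerivAt).differentiableAt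

theorem fderiv_matrix_mul {A B : Phase n → Mat n} {s : Phase n} (hA : DifferentiableAt ℂ A s)
    (hB : DifferentiableAt ℂ B s) (v : Phase n) :
    fderiv ℂ (fun t => A t * B t) s v = fderiv ℂ A s v * B s + A s * fderiv ℂ B s v :=
  (DFunLike.congr_fun
    ((mulCLM n).hasFDerivAt_of_bilinear hA.hasFDerivAt hB.hasFDerivAt).fderiv v).trans
    (add_comm _ _)

theorem fderiv_matrix_sub {A B : Phase n → Mat n} {s : Phase n} (hA : DifferentiableAt ℂ A s)
    (hB : DifferentiableAt ℂ B s) (v : Phase n) :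
    fderiv ℂ (fun t => A t - B t) s v = fderiv ℂ A s v - fderiv ℂ B s v :=
  DFunLike.congr_fun (hA.hasFDerivAt.fun_sub hB.hasFDerivAt).fderiv v

theorem fderiv_matrix_neg {A : Phase n → Mat n} {s : Phase n} (hA : DifferentiableAt ℂ A s)
    (v : Phase n) : fderiv ℂ (fun t => -A t) s v = -fderiv ℂ A s v :=
  DFunLike.congr_fun hA.hasFDerivAt.fun_neg.fderiv v

theorem differentiableAt_matrix_trace {A : Phase n → Mat n} {s : Phase n}
    (hA : DifferentiableAt ℂ A s) : DifferentiableAt ℂ (fun t => (A t).trace) s :=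
  ((traceCLM n).hasFDerivAt.comp s hA.hasFDerivAt).differentiableAt

theorem fderiv_matrix_trace {A : Phase n → Mat n} {s : Phase n} (hA : DifferentiableAt ℂ A s)
    (v : Phase n) : fderiv ℂ (fun t => (A t).trace) s v = (fderiv ℂ A s v).trace :=
  DFunLike.congr_fun ((traceCLM n).hasFDerivAt.comp s hA.hasFDerivAt).fderiv v

theorem fderiv_matrix_mul_const {A : Phase n → Mat n} {s : Phase n} (hA : DifferentiableAt ℂ A s)
    (B : Mat n) (v : Phase n) : fderiv ℂ (fun t => A t * B) s v = fderiv ℂ A s v * B :=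
  DFunLike.congr_fun (((mulCLM n).flip B).hasFDerivAt.comp s hA.hasFDerivAt).fderiv v

theorem fderiv_matrix_inv {A : Phase n → Mat n} {s : Phase n} (hA : DifferentiableAt ℂ A s)
    (hA' : DifferentiableAt ℂ (fun t => (A t)⁻¹) s)
    (h : ∀ᶠ t in nhds s, IsUnit (A t).det) (v : Phase n) :
    fderiv ℂ (fun t => (A t)⁻¹) s v = -((A s)⁻¹ * fderiv ℂ A s v * (A s)⁻¹) := by
  -- The derivative of the inverse comes from differentiating A⁻¹ A = 1, valid only near s.
  have h1 : (fun t => (A t)⁻¹ * A t) =ᶠ[nhds s] fun _ => 1 :=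
    h.mono fun t ht => Matrix.nonsing_inv_mul _ ht
  have h0 : fderiv ℂ (fun t => (A t)⁻¹ * A t) s v = 0 := by
    refine DFunLike.congr_fun (HasFDerivAt.fderiv (f' := 0) ?_) v
    exact (hasFDerivAt_const (1 : Mat n) s).congr_of_eventuallyEq h1
  have h2 := fderiv_matrix_mul hA' hA v
  rw [h0] at h2
  have h3 := congrArg (· * (A s)⁻¹) h2
  simp only [zero_mul, add_mul, mul_assoc, Matrix.mul_nonsing_inv _ h.self_of_nhds, mul_one] at h3
  rw [eq_neg_iff_add_eq_zero, h3, mul_assoc]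

/-! ### The canonical one-form and the symplectic form -/

theorem contDiff_lam : ContDiff ℂ 1 (lam : Phase n → Mat n) := contDiff_fst

theorem contDiff_frm : ContDiff ℂ 1 (frm : Phase n → Mat n) := contDiff_fst.comp contDiff_snd

theorem contDiff_phi1 : ContDiff ℂ 1 (phi1 : Phase n → Mat n) := contDiff_snd.comp contDiff_snd

theorem fderiv_lam (s v : Phase n) : fderiv ℂ lam s v = lam v := by
  change fderiv ℂ (ContinuousLinearMap.fst ℂ (Mat n) (Mat n × Mat n)) s v = _
  rw [ContinuousLinearMap.fderiv]
  rfl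

theorem fderiv_frm (s v : Phase n) : fderiv ℂ frm s v = frm v := by
  change fderiv ℂ ((ContinuousLinearMap.fst ℂ (Mat n) (Mat n)).comp
    (ContinuousLinearMap.snd ℂ (Mat n) (Mat n × Mat n))) s v = _
  rw [ContinuousLinearMap.fderiv]
  rfl

theorem fderiv_phi1 (s v : Phase n) : fderiv ℂ phi1 s v = phi1 v := by
  change fderiv ℂ ((ContinuousLinearMap.snd ℂ (Mat n) (Mat n)).comp
    (ContinuousLinearMap.snd ℂ (Mat n) (Mat n × Mat n))) s v = _
  rw [ContinuousLinearMap.fderiv]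
  rfl

theorem differentiable_lam : Differentiable ℂ (lam : Phase n → Mat n) :=
  contDiff_lam.differentiable one_ne_zero

theorem differentiable_frm : Differentiable ℂ (frm : Phase n → Mat n) :=
  contDiff_frm.differentiable one_ne_zero

theorem differentiable_phi1 : Differentiable ℂ (phi1 : Phase n → Mat n) :=
  contDiff_phi1.differentiable one_ne_zero

/-- The derivative of `phi2` at `s` in the direction `v`. -/
def dphi2 (s v : Phase n) : Mat n :=
  lam v * phi1 s + lam s * phi1 v - (phi1 v * lam s + phi1 s * lam v)

theorem contDiff_phi2 : ContDiff ℂ 1 (phi2 : Phase n → Mat n) := by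
  rw [← contDiffOn_univ]
  exact (contDiffOn_matrix_mul contDiff_lam.contDiffOn contDiff_phi1.contDiffOn).sub
    (contDiffOn_matrix_mul contDiff_phi1.contDiffOn contDiff_lam.contDiffOn)

theorem differentiable_phi2 : Differentiable ℂ (phi2 : Phase n → Mat n) :=
  contDiff_phi2.differentiable one_ne_zero

theorem fderiv_phi2 (s v : Phase n) : fderiv ℂ phi2 s v = dphi2 s v := by
  change fderiv ℂ (fun s => lam s * phi1 s - phi1 s * lam s) s v = _
  rw [fderiv_matrix_sub (differentiableAt_matrix_mul (differentiable_lam s) (differentiable_phi1 s))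
    (differentiableAt_matrix_mul (differentiable_phi1 s) (differentiable_lam s)),
    fderiv_matrix_mul (differentiable_lam s) (differentiable_phi1 s),
    fderiv_matrix_mul (differentiable_phi1 s) (differentiable_lam s), fderiv_lam, fderiv_phi1]
  rfl

/-- The triples whose trivialization is invertible. -/
def framed (n : ℕ) : Set (Phase n) := {s | IsUnit (frm s).det}

theorem isOpen_framed : IsOpen (framed n) := by
  have : Continuous fun s : Phase n => (frm s).det := by
    have := contDiffOn_matrix_det ((contDiff_frm (n := n)).contDiffOn (s := Set.univ))
    rw [contDiffOn_univ] at this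
    exact this.continuous
  simpa [framed, isUnit_iff_ne_zero] using isOpen_ne.preimage this

theorem contDiffOn_inv_frm : ContDiffOn ℂ 1 (fun t : Phase n => (frm t)⁻¹) (framed n) :=
  contDiffOn_matrix_inv contDiff_frm.contDiffOn fun _ h => h

theorem differentiableAt_inv_frm {s : Phase n} (hs : IsUnit (frm s).det) :
    DifferentiableAt ℂ (fun t : Phase n => (frm t)⁻¹) s :=
  (contDiffOn_inv_frm.differentiableOn one_ne_zero).differentiableAt (isOpen_framed.mem_nhds hs)

theorem fderiv_inv_frm {s : Phase n} (hs : IsUnit (frm s).det) (v : Phase n) :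
    fderiv ℂ (fun t : Phase n => (frm t)⁻¹) s v = -((frm s)⁻¹ * frm v * (frm s)⁻¹) := by
  rw [fderiv_matrix_inv (differentiable_frm s) (differentiableAt_inv_frm hs)
    (isOpen_framed.mem_nhds hs), fderiv_frm]

/-- The derivative of `U⁻¹ Φ₂` at `s` in the direction `v`. -/
noncomputable def dcoframe (s v : Phase n) : Mat n :=
  -((frm s)⁻¹ * frm v * (frm s)⁻¹) * phi2 s + (frm s)⁻¹ * dphi2 s v

theorem differentiableAt_coframe {s : Phase n} (hs : IsUnit (frm s).det) :
    DifferentiableAt ℂ (fun t : Phase n => (frm t)⁻¹ * phi2 t) s :=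
  differentiableAt_matrix_mul (differentiableAt_inv_frm hs) (differentiable_phi2 s)

theorem fderiv_coframe {s : Phase n} (hs : IsUnit (frm s).det) (v : Phase n) :
    fderiv ℂ (fun t : Phase n => (frm t)⁻¹ * phi2 t) s v = dcoframe s v := by
  rw [fderiv_matrix_mul (differentiableAt_inv_frm hs) (differentiable_phi2 s), fderiv_inv_frm hs,
    fderiv_phi2, dcoframe]

theorem fderiv_moment {s : Phase n} (hs : IsUnit (frm s).det) (v : Phase n) :
    fderiv ℂ moment s v = -(dcoframe s v * frm s + (frm s)⁻¹ * phi2 s * frm v) := by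
  change fderiv ℂ (fun t => -((frm t)⁻¹ * phi2 t * frm t)) s v = _
  rw [fderiv_matrix_neg
    (differentiableAt_matrix_mul (differentiableAt_coframe hs) (differentiable_frm s)),
    fderiv_matrix_mul (differentiableAt_coframe hs) (differentiable_frm s),
    fderiv_coframe hs, fderiv_frm]

theorem differentiableAt_moment {s : Phase n} (hs : IsUnit (frm s).det) :
    DifferentiableAt ℂ moment s :=
  (differentiableAt_matrix_mul (differentiableAt_coframe hs) (differentiable_frm s)).neg

/-- The canonical one-form `Tr Φ₁ dΛ - Tr U⁻¹ Φ₂ dU`. -/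
noncomputable def canonicalForm (s : Phase n) : Phase n →L[ℂ] ℂ :=
  (traceCLM n).comp (((mulCLM n (phi1 s)).comp (ContinuousLinearMap.fst ℂ _ _)) -
    (mulCLM n ((frm s)⁻¹ * phi2 s)).comp
      ((ContinuousLinearMap.fst ℂ _ _).comp (ContinuousLinearMap.snd ℂ (Mat n) (Mat n × Mat n))))

theorem canonicalForm_apply (s v : Phase n) : canonicalForm s v =
    (phi1 s * lam v).trace - ((frm s)⁻¹ * phi2 s * frm v).trace := by
  change (phi1 s * lam v - (frm s)⁻¹ * phi2 s * frm v).trace = _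
  rw [Matrix.trace_sub]

theorem isCanonicalOneForm_canonicalForm (hz : z₁ ≠ z₂) :
    IsCanonicalOneForm z₁ z₂ (canonicalForm (n := n)) := fun s hs v χ h => by
  rw [canonicalForm_apply]
  exact (serrePairing_laxForm hz hs h (phi1 s)).symm

/-- Every tangent vector has a representing cocycle, so the defining property determines θ wherever
U is invertible. -/
theorem IsCanonicalOneForm.apply (hz : z₁ ≠ z₂) {θ : Phase n → Phase n →L[ℂ] ℂ}
    (hθ : IsCanonicalOneForm z₁ z₂ θ) {s : Phase n} (hs : IsUnit (frm s).det) (v : Phase n) :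
    θ s v = (phi1 s * lam v).trace - ((frm s)⁻¹ * phi2 s * frm v).trace := by
  obtain ⟨χ, h⟩ := exists_isKodairaSpencer hz (lam s) hs (lam v) (frm v)
  rw [hθ s hs v χ h]
  exact serrePairing_laxForm hz hs h (phi1 s)

theorem contDiffOn_canonicalForm_apply (w : Phase n) : ContDiffOn ℂ 1
    (fun t : Phase n => (phi1 t * lam w).trace - ((frm t)⁻¹ * phi2 t * frm w).trace)
    (framed n) :=
  (contDiffOn_matrix_trace (contDiffOn_matrix_mul contDiff_phi1.contDiffOn contDiffOn_const)).sub
    (contDiffOn_matrix_trace (contDiffOn_matrix_mul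
      (contDiffOn_matrix_mul contDiffOn_inv_frm contDiff_phi2.contDiffOn) contDiffOn_const))

/-- The symplectic form `d (Tr Φ₁ dΛ - Tr U⁻¹ Φ₂ dU)`. -/
noncomputable def omega (s v w : Phase n) : ℂ :=
  (phi1 v * lam w).trace - (phi1 w * lam v).trace -
    ((dcoframe s v * frm w).trace - (dcoframe s w * frm v).trace)

/-- No regularity of θ is assumed. It agrees with the explicit smooth formula on the open set of
invertible U, which gives differentiability and the value of dθ there. -/
theorem IsCanonicalOneForm.extD_eq (hz : z₁ ≠ z₂) {θ : Phase n → Phase n →L[ℂ] ℂ}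
    (hθ : IsCanonicalOneForm z₁ z₂ θ) {s : Phase n} (hs : IsUnit (frm s).det) (v w : Phase n) :
    extD θ s v w = omega s v w := by
  have hnhds := isOpen_framed.mem_nhds (show s ∈ framed n from hs)
  have hdiff : DifferentiableAt ℂ θ s := by
    have hc := (contDiffOn_clm_apply (𝕜 := ℂ) (n := 1) (D := Phase n) (E := Phase n) (F := ℂ)
      (f := θ) (s := framed n)).2 fun y =>
        (contDiffOn_canonicalForm_apply y).congr fun t ht => hθ.apply hz ht y
    exact (hc.differentiableOn one_ne_zero).differentiableAt hnhds
  have hθw (v w : Phase n) : fderiv ℂ (fun t => θ t w) s v =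
      (phi1 v * lam w).trace - (dcoframe s v * frm w).trace := by
    have h1 : (fun t => θ t w) =ᶠ[nhds s] fun t =>
        (phi1 t * lam w).trace - ((frm t)⁻¹ * phi2 t * frm w).trace :=
      Filter.eventually_of_mem hnhds fun t ht => hθ.apply hz ht w
    have d1 := differentiableAt_matrix_mul (differentiable_phi1 s) (differentiableAt_const (lam w))
    have d2 := differentiableAt_matrix_mul (differentiableAt_coframe hs)
      (differentiableAt_const (frm w))
    have h2 : fderiv ℂ (fun t : Phase n =>
        (phi1 t * lam w).trace - ((frm t)⁻¹ * phi2 t * frm w).trace) s v =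
        fderiv ℂ (fun t : Phase n => (phi1 t * lam w).trace) s v -
        fderiv ℂ (fun t : Phase n => ((frm t)⁻¹ * phi2 t * frm w).trace) s v :=
      DFunLike.congr_fun ((differentiableAt_matrix_trace d1).hasFDerivAt.fun_sub
        (differentiableAt_matrix_trace d2).hasFDerivAt).fderiv v
    rw [h1.fderiv_eq, h2, fderiv_matrix_trace d1, fderiv_matrix_trace d2,
      fderiv_matrix_mul_const (differentiable_phi1 s),
      fderiv_matrix_mul_const (differentiableAt_coframe hs), fderiv_coframe hs, fderiv_phi1]
  have hd : DifferentiableAt ℂ (fun t => ContinuousAlternatingMap.ofSubsingleton ℂ (Phase n) ℂ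
      (0 : Fin 1) (θ t)) s :=
    (ContinuousAlternatingMap.ofSubsingletonLIE (𝕜 := ℂ) (E := Phase n) (F := ℂ)
      (0 : Fin 1)).differentiableAt.comp s hdiff
  refine (extDeriv_apply hd _).trans ((Fin.sum_univ_two _).trans ?_)
  have e0 := hθw v w
  have e1 := hθw w v
  have e : (-1 : ℂ) ^ 0 * fderiv ℂ (fun t => θ t w) s v +
      (-1 : ℂ) ^ 1 * fderiv ℂ (fun t => θ t v) s w = omega s v w := by
    rw [e0, e1, omega]
    ring
  refine Eq.trans ?_ e
  refine congrArg₂ (· + ·) ?_ ?_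
  · rw [Fin.val_zero, pow_zero, pow_zero, one_smul, one_mul]
    rfl
  · rw [Fin.val_one, pow_one, pow_one, neg_one_smul, neg_one_mul]
    rfl

/-! ### The kernel of the symplectic form and the moment map -/

theorem trace_dcoframe_mul {s v w : Phase n} (hs : IsUnit (frm s).det) {ξ η : Mat n}
    (hv : frm v = ξ * frm s) (hw : frm w = η * frm s) :
    (dcoframe s v * frm w).trace = ((dphi2 s v - ξ * phi2 s) * η).trace := by
  have hU := Matrix.mul_nonsing_inv _ hs
  have h1 : dcoframe s v * frm w = (frm s)⁻¹ * ((dphi2 s v - ξ * phi2 s) * η * frm s) := by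
    have h2 : (frm s)⁻¹ * frm v * (frm s)⁻¹ = (frm s)⁻¹ * ξ := by
      rw [hv, mul_assoc, mul_assoc, hU, mul_one]
    rw [dcoframe, hw, h2]
    noncomm_ring
  rw [h1, Matrix.trace_mul_comm, mul_assoc _ (frm s), hU, mul_one]

/-- In the right-invariant frame, with U varying by ξU and ηU, all inverses cancel under the trace.
Later identities for ω are then cyclic rearrangements. -/
theorem omega_eq {s v w : Phase n} (hs : IsUnit (frm s).det) {ξ η : Mat n}
    (hv : frm v = ξ * frm s) (hw : frm w = η * frm s) :
    omega s v w = (phi1 v * lam w).trace - (phi1 w * lam v).trace -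
      (((dphi2 s v - ξ * phi2 s) * η).trace - ((dphi2 s w - η * phi2 s) * ξ).trace) := by
  rw [omega, trace_dcoframe_mul hs hv hw, trace_dcoframe_mul hs hw hv]

theorem dphi2_infGauge (ξ : Mat n) (s : Phase n) :
    dphi2 s (infGauge ξ s) = ξ * phi2 s - phi2 s * ξ := by
  simp only [dphi2, infGauge, phi2, lam, phi1]
  noncomm_ring

theorem exists_frm_eq {s : Phase n} (hs : IsUnit (frm s).det) (w : Phase n) :
    ∃ η, frm w = η * frm s :=
  ⟨frm w * (frm s)⁻¹, by rw [mul_assoc, Matrix.nonsing_inv_mul _ hs, mul_one]⟩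

theorem omega_infGauge {s : Phase n} (hs : IsUnit (frm s).det) (ξ : Mat n) (w : Phase n) :
    omega s (infGauge ξ s) w = 0 := by
  obtain ⟨η, hw⟩ := exists_frm_eq hs w
  rw [omega_eq hs (show frm (infGauge ξ s) = ξ * frm s from rfl) hw, dphi2_infGauge]
  have h1 := Matrix.trace_mul_comm (s.1 * s.2.2 * ξ) η
  have h2 := Matrix.trace_mul_comm (s.2.2 * s.1 * ξ) η
  simp only [dphi2, infGauge, phi2, lam, phi1, mul_sub, sub_mul, add_mul,
    Matrix.trace_add, Matrix.trace_sub, ← mul_assoc] at h1 h2 ⊢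
  linear_combination h1 - h2 - Matrix.trace_mul_cycle s.2.2 w.1 ξ
    - Matrix.trace_mul_cycle s.2.2 ξ w.1 - Matrix.trace_mul_cycle w.2.2 ξ s.1

/-- The frame component of v already fixes ξ. Test vectors along Φ₁ force the Λ-component to be [ξ,
Λ], and those along Λ force the Φ₁-component to be [ξ, Φ₁]; variations of U are not needed. -/
theorem omega_eq_zero_iff {s : Phase n} (hs : IsUnit (frm s).det) (v : Phase n) :
    (∀ w, omega s v w = 0) ↔ ∃ ξ : Mat n, v = infGauge ξ s := by
  constructor
  · intro h
    obtain ⟨ξ, hv⟩ := exists_frm_eq hs v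
    refine ⟨ξ, Prod.ext ?_ (Prod.ext hv ?_)⟩
    · refine (sub_eq_zero.1 (trace_mul_left_eq_zero fun W => ?_)).symm
      have := h (0, 0, W)
      rw [omega_eq hs hv (show frm (0, 0, W) = 0 * frm s by rw [zero_mul]; rfl)] at this
      simp only [dphi2, lam, phi1, mul_zero, zero_mul, sub_mul, zero_add, add_zero,
        sub_zero, Matrix.trace_zero, Matrix.trace_sub, zero_sub, sub_neg_eq_add] at this
      simp only [infGauge, lam, mul_sub, Matrix.trace_sub, ← mul_assoc]
      linear_combination this + Matrix.trace_mul_cycle W ξ s.1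
    · refine sub_eq_zero.1 (trace_mul_left_eq_zero fun W => ?_)
      have := h (W, 0, 0)
      rw [omega_eq hs hv (show frm (W, 0, 0) = 0 * frm s by rw [zero_mul]; rfl)] at this
      simp only [dphi2, lam, phi1, mul_zero, zero_mul, sub_mul, zero_add, add_zero,
        sub_zero, Matrix.trace_zero, Matrix.trace_sub, zero_sub, sub_neg_eq_add] at this
      simp only [infGauge, phi1, mul_sub, Matrix.trace_sub, ← mul_assoc]
      linear_combination this - Matrix.trace_mul_comm v.2.2 W
        - Matrix.trace_mul_cycle W ξ s.2.2
  · rintro ⟨ξ, rfl⟩ w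
    exact omega_infGauge hs ξ w

theorem canonicalForm_infGauge {s : Phase n} (hs : IsUnit (frm s).det) (ξ : Mat n) :
    (phi1 s * lam (infGauge ξ s)).trace - ((frm s)⁻¹ * phi2 s * frm (infGauge ξ s)).trace = 0 := by
  have h1 : ((frm s)⁻¹ * phi2 s * frm (infGauge ξ s)).trace = (phi2 s * ξ).trace := by
    change ((frm s)⁻¹ * phi2 s * (ξ * frm s)).trace = _
    rw [mul_assoc, Matrix.trace_mul_comm, mul_assoc, mul_assoc, Matrix.mul_nonsing_inv _ hs,
      mul_one]
  rw [h1]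
  simp only [infGauge, phi2, lam, phi1, mul_sub, sub_mul, Matrix.trace_sub, ← mul_assoc]
  linear_combination Matrix.trace_mul_cycle s.2.2 ξ s.1

theorem isUnit_det_frm_act (g h : GL (Fin n) ℂ) {s : Phase n} (hs : IsUnit (frm s).det) :
    IsUnit (frm (act g h s)).det := by
  change IsUnit ((g : Mat n) * frm s * (h : Mat n)).det
  rw [Matrix.det_mul, Matrix.det_mul]
  exact ((g.isUnit.map Matrix.detMonoidHom).mul hs).mul (h.isUnit.map Matrix.detMonoidHom)

theorem canonicalForm_act (g h : GL (Fin n) ℂ) {s : Phase n} (v : Phase n) :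
    (phi1 (act g h s) * lam (act g h v)).trace -
      ((frm (act g h s))⁻¹ * phi2 (act g h s) * frm (act g h v)).trace =
    (phi1 s * lam v).trace - ((frm s)⁻¹ * phi2 s * frm v).trace := by
  have hg : ((g⁻¹ : GL (Fin n) ℂ) : Mat n) * (g : Mat n) = 1 := g.inv_mul
  have hh : (h : Mat n) * ((h⁻¹ : GL (Fin n) ℂ) : Mat n) = 1 := h.mul_inv
  have hgl (M : Mat n) : ((g⁻¹ : GL (Fin n) ℂ) : Mat n) * ((g : Mat n) * M) = M := by
    rw [← mul_assoc, hg, one_mul]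
  have hU : (frm (act g h s))⁻¹ =
      ((h⁻¹ : GL (Fin n) ℂ) : Mat n) * (frm s)⁻¹ * ((g⁻¹ : GL (Fin n) ℂ) : Mat n) := by
    change ((g : Mat n) * frm s * (h : Mat n))⁻¹ = _
    rw [Matrix.mul_inv_rev, Matrix.mul_inv_rev, Matrix.coe_units_inv, Matrix.coe_units_inv,
      mul_assoc]
  rw [phi2_act, hU]
  simp only [act, lam, phi1, frm, mul_assoc, hgl]
  congr 1
  · rw [Matrix.trace_mul_comm]
    simp only [mul_assoc, hg, mul_one]
  · rw [Matrix.trace_mul_comm]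
    simp only [mul_assoc, hh, mul_one]

/-- A change of trivialization leaves Φ₂ fixed, so only the variation of U⁻¹ contributes; cyclicity
matches the result with the derivative of Tr(μA). -/
theorem omega_infFrame {s : Phase n} (hs : IsUnit (frm s).det) (A : Mat n) (w : Phase n) :
    omega s (infFrame A s) w = -fderiv ℂ (fun t => (moment t * A).trace) s w := by
  have hU : (frm s)⁻¹ * (frm s * A) = A := by
    rw [← mul_assoc, Matrix.nonsing_inv_mul _ hs, one_mul]
  have hm := differentiableAt_moment hs
  rw [fderiv_matrix_trace (differentiableAt_matrix_mul hm (differentiableAt_const A)),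
    fderiv_matrix_mul_const hm, fderiv_moment hs]
  have h1 : dcoframe s (infFrame A s) = -(A * (frm s)⁻¹ * phi2 s) := by
    simp only [dcoframe, dphi2, infFrame, lam, phi1]
    change -((frm s)⁻¹ * (frm s * A) * (frm s)⁻¹) * phi2 s + _ = _
    rw [hU]
    simp
  rw [omega, h1]
  change (0 * lam w).trace - (phi1 w * 0).trace -
    ((-(A * (frm s)⁻¹ * phi2 s) * frm w).trace - (dcoframe s w * (frm s * A)).trace) = _
  simp only [zero_mul, mul_zero, neg_mul, Matrix.trace_neg, add_mul, Matrix.trace_add,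
    Matrix.trace_zero, ← mul_assoc]
  have := Matrix.trace_mul_comm A ((frm s)⁻¹ * phi2 s * frm w)
  simp only [← mul_assoc] at this
  linear_combination this

theorem canonicalForm_infFrame (s : Phase n) (A : Mat n) :
    (phi1 s * lam (infFrame A s)).trace - ((frm s)⁻¹ * phi2 s * frm (infFrame A s)).trace =
      (moment s * A).trace := by
  change (phi1 s * 0).trace - ((frm s)⁻¹ * phi2 s * (frm s * A)).trace =
    (-((frm s)⁻¹ * phi2 s * frm s) * A).trace
  simp [mul_assoc]

/-! ### The principal cell -/

/-- A matrix with distinct eigenvalues is diagonalizable. -/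
theorem exists_conj_eq_diagonal {L : Mat n} (hL : L.charpoly.roots.Nodup) :
    ∃ (g : GL (Fin n) ℂ) (x : Fin n → ℂ), Function.Injective x ∧
      (g : Mat n) * L * ((g⁻¹ : GL (Fin n) ℂ) : Mat n) = Matrix.diagonal x := by
  have hcard : L.charpoly.roots.toFinset.card = n := by
    rw [Multiset.toFinset_card_of_nodup hL,
      ← (IsAlgClosed.splits L.charpoly).natDegree_eq_card_roots, Matrix.charpoly_natDegree_eq_dim,
      Fintype.card_fin]
  let e := (L.charpoly.roots.toFinset.equivFinOfCardEq hcard).symm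
  let x : Fin n → ℂ := fun i => (e i : ℂ)
  have hx : Function.Injective x := fun i j h => e.injective (Subtype.ext h)
  have hev (i) : ∃ v : Fin n → ℂ, Module.End.HasEigenvector (Matrix.toLin' L) (x i) v := by
    refine Module.End.HasEigenvalue.exists_hasEigenvector ?_
    rw [Module.End.hasEigenvalue_iff_isRoot_charpoly, Matrix.charpoly_toLin']
    exact Polynomial.isRoot_of_mem_roots (Multiset.mem_toFinset.1 (e i).2)
  choose v hv using hev
  have hli : LinearIndependent ℂ v :=
    Module.End.eigenvectors_linearIndependent' (Matrix.toLin' L) x hx v hv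
  let P : Mat n := (Matrix.of v)ᵀ
  have hP : IsUnit P := Matrix.linearIndependent_cols_iff_isUnit.1 hli
  have hLP : L * P = P * Matrix.diagonal x := by
    ext i j
    have := congrFun (hv j).apply_eq_smul i
    rw [Matrix.toLin'_apply] at this
    rw [Matrix.mul_diagonal, Matrix.mul_apply]
    simpa [Matrix.mulVec, dotProduct, P, mul_comm] using this
  refine ⟨hP.unit⁻¹, x, hx, ?_⟩
  rw [inv_inv, IsUnit.unit_spec, mul_assoc, hLP, ← mul_assoc]
  nth_rw 2 [← hP.unit_spec]
  rw [Units.inv_mul, one_mul]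

theorem cmMatrix_apply_self (q : Reduced n) (i : Fin n) : cmMatrix q i i = q.2.1 i := by
  simp [cmMatrix]

theorem cmMatrix_apply_ne (q : Reduced n) {i j : Fin n} (h : i ≠ j) :
    cmMatrix q i j = q.2.2 i j / (q.1 i - q.1 j) := by
  simp [cmMatrix, h]

/-- Commutation with diag x multiplies the entry (i, j) by x i - x j, which cancels the denominators
of `cmMatrix`. -/
theorem phi2_slice (U : Mat n) {q : Reduced n} (hq : Function.Injective q.1)
    (hf : ∀ i, q.2.2 i i = 0) : phi2 (slice U q) = q.2.2 := by
  ext i j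
  change (Matrix.diagonal q.1 * cmMatrix q - cmMatrix q * Matrix.diagonal q.1) i j = _
  rw [Matrix.sub_apply, Matrix.diagonal_mul, Matrix.mul_diagonal]
  by_cases h : i = j
  · subst h
    rw [hf]
    ring
  · have : q.1 i - q.1 j ≠ 0 := sub_ne_zero.2 (hq.ne h)
    rw [cmMatrix_apply_ne _ h]
    field_simp

theorem slice_mem_principalCell {U : Mat n} {q : Reduced n} (hU : IsUnit U.det)
    (hq : Function.Injective q.1) : slice U q ∈ principalCell n := by
  refine ⟨hU, ?_⟩
  change (Matrix.diagonal q.1).charpoly.roots.Nodup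
  rw [Matrix.charpoly_diagonal, Polynomial.roots_prod _ _
    (Finset.prod_ne_zero_iff.2 fun i _ => Polynomial.X_sub_C_ne_zero _)]
  simp only [Polynomial.roots_X_sub_C]
  rw [Multiset.bind_singleton]
  exact Finset.univ.nodup.map hq

/-- After diagonalizing Λ, take f to be the transformed Φ₂; its diagonal vanishes because it is a
commutator with a diagonal matrix. The moment map is unchanged by g, whence f = -U μ U⁻¹. -/
theorem exists_act_eq_slice {s : Phase n} (hs : s ∈ principalCell n) :
    ∃ (g : GL (Fin n) ℂ) (U : Mat n) (q : Reduced n), act g 1 s = slice U q ∧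
      Function.Injective q.1 ∧ (∀ i, q.2.2 i i = 0) ∧ q.2.2 = -(U * moment s * U⁻¹) := by
  obtain ⟨g, x, hx, hg⟩ := exists_conj_eq_diagonal hs.2
  set s' := act g 1 s with hs'
  have hl : lam s' = Matrix.diagonal x := hg
  have hp (i j) : phi2 s' i j = (x i - x j) * phi1 s' i j := by
    rw [phi2, hl, Matrix.sub_apply, Matrix.diagonal_mul, Matrix.mul_diagonal]
    ring
  refine ⟨g, frm s', (x, fun i => phi1 s' i i, phi2 s'), Prod.ext hl (Prod.ext rfl ?_), hx,
    fun i => ?_, ?_⟩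
  · change phi1 s' = cmMatrix _
    ext i j
    by_cases h : i = j
    · subst h
      rw [cmMatrix_apply_self]
    · have : x i - x j ≠ 0 := sub_ne_zero.2 (hx.ne h)
      rw [cmMatrix_apply_ne _ h]
      simp only [hp]
      field_simp
  · simp [hp]
  · have hU : (frm s')⁻¹ = (frm s)⁻¹ * ((g⁻¹ : GL (Fin n) ℂ) : Mat n) := by
      change ((g : Mat n) * frm s * 1)⁻¹ = _
      rw [mul_one, Matrix.mul_inv_rev, Matrix.coe_units_inv]
    have hU' : frm s' = (g : Mat n) * frm s := mul_one _
    have hm := Matrix.mul_nonsing_inv _ hs.1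
    change phi2 s' = _
    rw [hU, hU', hs', phi2_act, moment]
    calc (g : Mat n) * phi2 s * ((g⁻¹ : GL (Fin n) ℂ) : Mat n)
        = (g : Mat n) * (frm s * (frm s)⁻¹) * phi2 s * (frm s * (frm s)⁻¹) *
          ((g⁻¹ : GL (Fin n) ℂ) : Mat n) := by rw [hm, mul_one, mul_one]
      _ = _ := by noncomm_ring

theorem trace_mul_of_isDiag {A D : Mat n} (hD : D.IsDiag) :
    (A * D).trace = ∑ i, A i i * D i i := by
  simp only [Matrix.trace, Matrix.diag_apply, Matrix.mul_apply]
  refine Finset.sum_congr rfl fun i _ => Finset.sum_eq_single i (fun j _ hj => ?_) (by simp)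
  rw [hD hj, mul_zero]

/-- Conjugated by U, the equation dμ(v) = 0 says that Φ₂ varies by [ξ, Φ₂]. -/
theorem dphi2_of_fderiv_moment_eq_zero {s v : Phase n} (hs : IsUnit (frm s).det) {ξ : Mat n}
    (hv : frm v = ξ * frm s) (h : fderiv ℂ moment s v = 0) :
    dphi2 s v - ξ * phi2 s = -(phi2 s * ξ) := by
  have hU := Matrix.mul_nonsing_inv _ hs
  rw [fderiv_moment hs, neg_eq_zero, dcoframe, hv] at h
  have h1 := congrArg (fun M => frm s * M * (frm s)⁻¹) h
  simp only [mul_zero, zero_mul] at h1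
  have h2 : frm s * ((-((frm s)⁻¹ * (ξ * frm s) * (frm s)⁻¹) * phi2 s + (frm s)⁻¹ * dphi2 s v) *
      frm s + (frm s)⁻¹ * phi2 s * (ξ * frm s)) * (frm s)⁻¹ =
      -(frm s * (frm s)⁻¹ * ξ * (frm s * (frm s)⁻¹) * phi2 s * (frm s * (frm s)⁻¹)) +
        frm s * (frm s)⁻¹ * dphi2 s v * (frm s * (frm s)⁻¹) +
        frm s * (frm s)⁻¹ * phi2 s * ξ * (frm s * (frm s)⁻¹) := by noncomm_ring
  rw [h2, hU] at h1
  simp only [one_mul, mul_one] at h1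
  rw [eq_neg_iff_add_eq_zero, ← h1]
  abel

/-- On the level the frame terms of ω collapse to Tr(Φ₂ [ξ, η]), the orbit term; diagonal variations
of Λ see only the diagonal of Φ₁. -/
theorem omega_of_fderiv_moment_eq_zero {s v w : Phase n} (hs : IsUnit (frm s).det)
    (hv : (lam v).IsDiag) (hw : (lam w).IsDiag) (hv' : fderiv ℂ moment s v = 0)
    (hw' : fderiv ℂ moment s w = 0) :
    omega s v w = ∑ i, (phi1 v i i * lam w i i - phi1 w i i * lam v i i) -
      (moment s * (((frm s)⁻¹ * frm v) * ((frm s)⁻¹ * frm w) -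
        ((frm s)⁻¹ * frm w) * ((frm s)⁻¹ * frm v))).trace := by
  have hU := Matrix.mul_nonsing_inv _ hs
  obtain ⟨ξ, hξ⟩ := exists_frm_eq hs v
  obtain ⟨η, hη⟩ := exists_frm_eq hs w
  have key (ξ η : Mat n) :
      (moment s * (((frm s)⁻¹ * (ξ * frm s)) * ((frm s)⁻¹ * (η * frm s)))).trace
      = -(phi2 s * ξ * η).trace := by
    have : moment s * (((frm s)⁻¹ * (ξ * frm s)) * ((frm s)⁻¹ * (η * frm s))) =
        -((frm s)⁻¹ * (phi2 s * (frm s * (frm s)⁻¹) * ξ * (frm s * (frm s)⁻¹) * η * frm s)) := by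
      rw [moment]
      noncomm_ring
    rw [this, hU, Matrix.trace_neg, Matrix.trace_mul_comm]
    simp only [mul_assoc, hU, mul_one]
  rw [omega_eq hs hξ hη, dphi2_of_fderiv_moment_eq_zero hs hξ hv',
    dphi2_of_fderiv_moment_eq_zero hs hη hw', trace_mul_of_isDiag hv, trace_mul_of_isDiag hw,
    mul_sub, Matrix.trace_sub, hξ, hη, key, key, Finset.sum_sub_distrib]
  simp only [neg_mul, Matrix.trace_neg]

theorem trace_cmMatrix_mul_self (q : Reduced n) : (cmMatrix q * cmMatrix q).trace =
    ∑ i, q.2.1 i ^ 2 - ∑ ij ∈ (Finset.univ : Finset (Fin n)).offDiag,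
      q.2.2 ij.1 ij.2 * q.2.2 ij.2 ij.1 / (q.1 ij.1 - q.1 ij.2) ^ 2 := by
  have h1 : (cmMatrix q * cmMatrix q).trace =
      ∑ ij ∈ (Finset.univ : Finset (Fin n)) ×ˢ Finset.univ,
        cmMatrix q ij.1 ij.2 * cmMatrix q ij.2 ij.1 := by
    rw [Finset.sum_product]
    rfl
  rw [h1, ← Finset.diag_union_offDiag, Finset.sum_union (Finset.disjoint_diag_offDiag _),
    Finset.sum_diag, sub_eq_add_neg, ← Finset.sum_neg_distrib]
  congr 1
  · exact Finset.sum_congr rfl fun i _ => by rw [cmMatrix_apply_self, sq]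
  · refine Finset.sum_congr rfl fun ij hij => ?_
    have h := (Finset.mem_offDiag.1 hij).2.2
    -- The minus sign of the potential is that of (x i - x j)(x j - x i).
    rw [cmMatrix_apply_ne _ h, cmMatrix_apply_ne _ h.symm, div_mul_div_comm, ← div_neg]
    congr 1
    ring

theorem coeffAt_trace_higgs_sq (hz : z₁ ≠ z₂) (s : Phase n) :
    coeffAt z₁ (-4) (higgs z₁ z₂ s * higgs z₁ z₂ s).trace = (phi1 s * phi1 s).trace := by
  have h := matOrdAtLeast_laxForm_left hz (phi1 s) (phi2 s) (-phi2 s)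
  rw [coeffAt_trace, higgs, matCoeff_mul h h (by norm_num), (matCoeff_laxForm_left hz _ _ _).1]

theorem isInvariant_trace_phi1_sq : IsInvariant (fun s : Phase n => (phi1 s * phi1 s).trace) := by
  intro s _ g h
  change ((g : Mat n) * phi1 s * ((g⁻¹ : GL (Fin n) ℂ) : Mat n) *
    ((g : Mat n) * phi1 s * ((g⁻¹ : GL (Fin n) ℂ) : Mat n))).trace = (phi1 s * phi1 s).trace
  have hg : ((g⁻¹ : GL (Fin n) ℂ) : Mat n) * (g : Mat n) = 1 := g.inv_mul
  have hgl (M : Mat n) : ((g⁻¹ : GL (Fin n) ℂ) : Mat n) * ((g : Mat n) * M) = M := by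
    rw [← mul_assoc, hg, one_mul]
  simp only [mul_assoc, hgl]
  rw [Matrix.trace_mul_comm]
  simp only [mul_assoc, hg, mul_one]

/-! ### Derivatives of invariant functions along the orbits -/

theorem hasDerivAt_matrix_mul {A B : ℂ → Mat n} {A' B' : Mat n} {t : ℂ} (hA : HasDerivAt A A' t)
    (hB : HasDerivAt B B' t) : HasDerivAt (fun t => A t * B t) (A t * B' + A' * B t) t :=
  (mulCLM n).hasDerivAt_of_bilinear (u := A) (v := B) (fun _ => hA) (fun _ => hB)

theorem hasDerivAt_one_add_smul (ξ : Mat n) : HasDerivAt (fun t : ℂ => 1 + t • ξ) ξ 0 := by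
  have := ((hasDerivAt_id (0 : ℂ)).smul_const ξ).const_add 1
  rwa [one_smul] at this

theorem contDiff_one_add_smul (ξ : Mat n) : ContDiff ℂ 1 (fun t : ℂ => 1 + t • ξ) :=
  contDiff_const.add (contDiff_id.smul contDiff_const)

theorem isOpen_isUnit_one_add_smul (ξ : Mat n) : IsOpen {t : ℂ | IsUnit (1 + t • ξ).det} := by
  have h1 := contDiffOn_matrix_det ((contDiff_one_add_smul ξ).contDiffOn (s := Set.univ))
  rw [contDiffOn_univ] at h1
  simpa [isUnit_iff_ne_zero] using isOpen_ne.preimage h1.continuous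

theorem eventually_isUnit_one_add_smul (ξ : Mat n) :
    ∀ᶠ t : ℂ in nhds 0, IsUnit (1 + t • ξ).det :=
  (isOpen_isUnit_one_add_smul ξ).mem_nhds (by simp)

theorem hasDerivAt_inv_one_add_smul (ξ : Mat n) :
    HasDerivAt (fun t : ℂ => (1 + t • ξ)⁻¹) (-ξ) 0 := by
  have hd : DifferentiableAt ℂ (fun t : ℂ => (1 + t • ξ)⁻¹) 0 :=
    ((contDiffOn_matrix_inv (contDiff_one_add_smul ξ).contDiffOn fun t ht => ht).differentiableOn
      one_ne_zero).differentiableAt (eventually_isUnit_one_add_smul ξ)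
  have h1 := hasDerivAt_matrix_mul hd.hasDerivAt (hasDerivAt_one_add_smul ξ)
  have h2 : (fun t : ℂ => (1 + t • ξ)⁻¹ * (1 + t • ξ)) =ᶠ[nhds 0] fun _ => 1 :=
    (eventually_isUnit_one_add_smul ξ).mono fun t ht => Matrix.nonsing_inv_mul _ ht
  have h3 := (h1.congr_of_eventuallyEq h2.symm).unique (hasDerivAt_const (0 : ℂ) (1 : Mat n))
  simp only [zero_smul, add_zero, inv_one, one_mul, mul_one] at h3
  rw [← eq_neg_of_add_eq_zero_right h3]
  exact hd.hasDerivAt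

theorem fderiv_eq_zero_of_curve {F : Phase n → ℂ} {γ : ℂ → Phase n} {v : Phase n}
    (hF : DifferentiableAt ℂ F (γ 0)) (hγ : HasDerivAt γ v 0)
    (h : ∀ᶠ t in nhds 0, F (γ t) = F (γ 0)) : fderiv ℂ F (γ 0) v = 0 := by
  have h1 : HasDerivAt (fun t => F (γ t)) (fderiv ℂ F (γ 0) v) 0 :=
    hF.hasFDerivAt.comp_hasDerivAt (0 : ℂ) hγ
  exact h1.unique ((hasDerivAt_const (0 : ℂ) (F (γ 0))).congr_of_eventuallyEq h)

theorem IsInvariant.fderiv_infGauge {F : Phase n → ℂ} (hF : IsInvariant F) {s : Phase n}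
    (hs : s ∈ principalCell n) (hd : DifferentiableAt ℂ F s) (ξ : Mat n) :
    fderiv ℂ F s (infGauge ξ s) = 0 := by
  let γ : ℂ → Phase n := fun t => ((1 + t • ξ) * lam s * (1 + t • ξ)⁻¹, (1 + t • ξ) * frm s,
    (1 + t • ξ) * phi1 s * (1 + t • ξ)⁻¹)
  have h0 : γ 0 = s := by
    simp only [γ, zero_smul, add_zero, inv_one, one_mul, mul_one]
    rfl
  have hM := hasDerivAt_one_add_smul ξ
  have hN := hasDerivAt_inv_one_add_smul ξ
  have hc (A : Mat n) : HasDerivAt (fun t : ℂ => (1 + t • ξ) * A) (ξ * A) 0 := by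
    have := hasDerivAt_matrix_mul hM (hasDerivAt_const (0 : ℂ) A)
    rwa [mul_zero, zero_add] at this
  have hcc (A : Mat n) : HasDerivAt (fun t : ℂ => (1 + t • ξ) * A * (1 + t • ξ)⁻¹)
      (ξ * A - A * ξ) 0 := by
    have := hasDerivAt_matrix_mul (hc A) hN
    simp only [zero_smul, add_zero, inv_one, one_mul, mul_one, mul_neg] at this
    rwa [neg_add_eq_sub] at this
  have hγ : HasDerivAt γ (infGauge ξ s) 0 :=
    (hcc (lam s)).prodMk ((hc (frm s)).prodMk (hcc (phi1 s)))
  rw [← h0] at hd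
  have := fderiv_eq_zero_of_curve hd hγ ?_
  · rwa [h0] at this
  · filter_upwards [eventually_isUnit_one_add_smul ξ] with t ht
    rw [h0, ← hF s hs (Matrix.GeneralLinearGroup.mk'' _ ht) 1]
    refine congrArg F ?_
    simp only [γ, act, Matrix.coe_units_inv]
    change _ = ((1 + t • ξ) * lam s * (1 + t • ξ)⁻¹, (1 + t • ξ) * frm s * 1,
      (1 + t • ξ) * phi1 s * (1 + t • ξ)⁻¹)
    rw [mul_one]

theorem IsInvariant.fderiv_infFrame {F : Phase n → ℂ} (hF : IsInvariant F) {s : Phase n}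
    (hs : s ∈ principalCell n) (hd : DifferentiableAt ℂ F s) (A : Mat n) :
    fderiv ℂ F s (infFrame A s) = 0 := by
  let γ : ℂ → Phase n := fun t => (lam s, frm s * (1 + t • A), phi1 s)
  have h0 : γ 0 = s := by
    simp only [γ, zero_smul, add_zero, mul_one]
    rfl
  have hc : HasDerivAt (fun t : ℂ => frm s * (1 + t • A)) (frm s * A) 0 := by
    have := hasDerivAt_matrix_mul (hasDerivAt_const (0 : ℂ) (frm s)) (hasDerivAt_one_add_smul A)
    rwa [zero_mul, add_zero] at this
  have hγ : HasDerivAt γ (infFrame A s) 0 :=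
    (hasDerivAt_const (0 : ℂ) (lam s)).prodMk (hc.prodMk (hasDerivAt_const (0 : ℂ) (phi1 s)))
  rw [← h0] at hd
  have := fderiv_eq_zero_of_curve hd hγ ?_
  · rwa [h0] at this
  · filter_upwards [eventually_isUnit_one_add_smul A] with t ht
    rw [h0, ← hF s hs 1 (Matrix.GeneralLinearGroup.mk'' _ ht)]
    refine congrArg F ?_
    simp only [γ, act, Matrix.coe_units_inv]
    change _ = ((1 : Mat n) * lam s * (1 : Mat n)⁻¹, (1 : Mat n) * frm s * (1 + t • A),
      (1 : Mat n) * phi1 s * (1 : Mat n)⁻¹)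
    simp

/-! ### Hamiltonian vectors of invariant functions -/

theorem exists_eq_trace_mul (l : Mat n →ₗ[ℂ] ℂ) : ∃ a : Mat n, ∀ M, l M = (a * M).trace := by
  refine ⟨Matrix.of fun i j => l (Matrix.single j i 1), fun M => ?_⟩
  conv_lhs => rw [Matrix.matrix_eq_sum_single M]
  simp only [map_sum, Matrix.trace, Matrix.diag_apply, Matrix.mul_apply, Matrix.of_apply]
  rw [Finset.sum_comm]
  refine Finset.sum_congr rfl fun i _ => Finset.sum_congr rfl fun j _ => ?_
  rw [show Matrix.single j i (M j i) = M j i • Matrix.single j i (1 : ℂ) by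
    rw [Matrix.smul_single, smul_eq_mul, mul_one], map_smul, smul_eq_mul, mul_comm]

/-- The differential of an invariant function in terms of two matrices `a`, `c` with
`[Λ, a] + [Φ₁, c] = 0`. -/
theorem IsInvariant.exists_fderiv_eq {F : Phase n → ℂ} (hF : IsInvariant F) {s : Phase n}
    (hs : s ∈ principalCell n) (hd : DifferentiableAt ℂ F s) : ∃ a c : Mat n,
    (∀ v, fderiv ℂ F s v = (a * lam v).trace + (c * phi1 v).trace) ∧
      lam s * a - a * lam s + (phi1 s * c - c * phi1 s) = 0 := by
  set l := fderiv ℂ F s with hl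
  obtain ⟨a, ha⟩ := exists_eq_trace_mul
    ((l : Phase n →ₗ[ℂ] ℂ).comp (LinearMap.inl ℂ (Mat n) (Mat n × Mat n)))
  obtain ⟨c, hc⟩ := exists_eq_trace_mul
    ((l : Phase n →ₗ[ℂ] ℂ).comp ((LinearMap.inr ℂ (Mat n) (Mat n × Mat n)).comp
      (LinearMap.inr ℂ (Mat n) (Mat n))))
  have hv (v : Phase n) : l v = (a * lam v).trace + (c * phi1 v).trace := by
    -- Since U is invertible, every variation of U is a change of trivialization, which the
    -- differential kills.
    have h1 : v = (lam v, 0, 0) + ((0, 0, phi1 v) + infFrame ((frm s)⁻¹ * frm v) s) := by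
      refine Prod.ext ?_ (Prod.ext ?_ ?_)
      · exact (by rw [add_zero, add_zero] : lam v = lam v + (0 + 0))
      · change frm v = 0 + (0 + frm s * ((frm s)⁻¹ * frm v))
        rw [zero_add, zero_add, ← mul_assoc, Matrix.mul_nonsing_inv _ hs.1, one_mul]
      · exact (by rw [zero_add, add_zero] : phi1 v = 0 + (phi1 v + 0))
    have h2 : l (lam v, 0, 0) = (a * lam v).trace := ha (lam v)
    have h3 : l (0, 0, phi1 v) = (c * phi1 v).trace := hc (phi1 v)
    conv_lhs => rw [h1]
    rw [map_add, map_add, h2, h3, hl, hF.fderiv_infFrame hs hd, add_zero]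
  refine ⟨a, c, hv, trace_mul_left_eq_zero fun ξ => ?_⟩
  have h := hF.fderiv_infGauge hs hd ξ
  rw [← hl, hv] at h
  simp only [infGauge, lam, phi1, mul_sub, mul_add, Matrix.trace_sub, Matrix.trace_add,
    ← mul_assoc] at h ⊢
  linear_combination h - Matrix.trace_mul_cycle a ξ s.1 - Matrix.trace_mul_cycle s.1 a ξ
    + Matrix.trace_mul_cycle a s.1 ξ - Matrix.trace_mul_cycle c ξ s.2.2
    - Matrix.trace_mul_cycle s.2.2 c ξ + Matrix.trace_mul_cycle c s.2.2 ξ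

/-- The hypothesis says exactly that Φ₂ is stationary along (c, 0, -a). The frame terms of ω vanish
and the canonical pairing of Λ with Φ₁ remains. -/
theorem omega_of_gradient {s : Phase n} (hs : IsUnit (frm s).det) {a c : Mat n}
    (h : lam s * a - a * lam s + (phi1 s * c - c * phi1 s) = 0) (w : Phase n) :
    omega s (c, 0, -a) w = -((a * lam w).trace + (c * phi1 w).trace) := by
  obtain ⟨η, hη⟩ := exists_frm_eq hs w
  have h1 : dphi2 s (c, 0, -a) = 0 := by
    rw [← neg_eq_zero, ← h]
    simp only [dphi2, lam, phi1]
    noncomm_ring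
  rw [omega_eq hs (show frm (c, 0, -a) = 0 * frm s by rw [zero_mul]; rfl) hη, h1]
  simp only [lam, phi1, neg_mul, Matrix.trace_neg, mul_zero, zero_mul, sub_self,
    Matrix.trace_zero]
  rw [Matrix.trace_mul_comm w.2.2 c]
  ring

theorem omega_sub (s v v' w : Phase n) : omega s (v - v') w = omega s v w - omega s v' w := by
  have h : dcoframe s (v - v') = dcoframe s v - dcoframe s v' := by
    simp only [dcoframe, dphi2]
    change -((frm s)⁻¹ * (frm v - frm v') * (frm s)⁻¹) * phi2 s + (frm s)⁻¹ *
      ((lam v - lam v') * phi1 s + lam s * (phi1 v - phi1 v') -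
        ((phi1 v - phi1 v') * lam s + phi1 s * (lam v - lam v'))) = _
    noncomm_ring
  rw [omega, h]
  change ((phi1 v - phi1 v') * lam w).trace - (phi1 w * (lam v - lam v')).trace -
    (((dcoframe s v - dcoframe s v') * frm w).trace -
      (dcoframe s w * (frm v - frm v')).trace) = _
  simp only [omega, sub_mul, mul_sub, Matrix.trace_sub]
  ring

/-! ### The derivative of the slice -/

/-- The derivative of `slice U` at `q` in the direction `r`. -/
noncomputable def dslice (q r : Reduced n) : Phase n :=
  (Matrix.diagonal r.1, 0, Matrix.of fun i j => if i = j then r.2.1 i else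
    (r.2.2 i j * (q.1 i - q.1 j) - q.2.2 i j * (r.1 i - r.1 j)) / (q.1 i - q.1 j) ^ 2)

theorem hasDerivAt_slice (U : Mat n) {q : Reduced n} (hq : Function.Injective q.1)
    (r : Reduced n) : HasDerivAt (fun t : ℂ => slice U (q + t • r)) (dslice q r) 0 := by
  have hx (i : Fin n) : HasDerivAt (fun t : ℂ => q.1 i + t * r.1 i) (r.1 i) 0 := by
    simpa using ((hasDerivAt_id (0 : ℂ)).mul_const (r.1 i)).const_add (q.1 i)
  have hp (i : Fin n) : HasDerivAt (fun t : ℂ => q.2.1 i + t * r.2.1 i) (r.2.1 i) 0 := by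
    simpa using ((hasDerivAt_id (0 : ℂ)).mul_const (r.2.1 i)).const_add (q.2.1 i)
  have hf (i j : Fin n) :
      HasDerivAt (fun t : ℂ => q.2.2 i j + t * r.2.2 i j) (r.2.2 i j) 0 := by
    simpa using ((hasDerivAt_id (0 : ℂ)).mul_const (r.2.2 i j)).const_add (q.2.2 i j)
  have h1 : HasDerivAt (fun t : ℂ => Matrix.diagonal (q + t • r).1) (Matrix.diagonal r.1) 0 := by
    refine hasDerivAt_pi.2 fun i => hasDerivAt_pi.2 fun j => ?_
    by_cases h : i = j
    · subst h
      simpa using hx i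
    · simpa [Matrix.diagonal_apply_ne _ h] using hasDerivAt_const (0 : ℂ) (0 : ℂ)
  have h2 : HasDerivAt (fun t : ℂ => cmMatrix (q + t • r)) (dslice q r).2.2 0 := by
    refine hasDerivAt_pi.2 fun i => hasDerivAt_pi.2 fun j => ?_
    by_cases h : i = j
    · subst h
      simpa [cmMatrix, dslice] using hp i
    · have h0 : q.1 i - q.1 j ≠ 0 := sub_ne_zero.2 (hq.ne h)
      have := (hf i j).fun_div ((hx i).fun_sub (hx j)) (by simpa using h0)
      simpa [cmMatrix, dslice, h] using this
  exact h1.prodMk ((hasDerivAt_const (0 : ℂ) U).prodMk h2)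

theorem differentiableAt_slice (U : Mat n) {q : Reduced n} (hq : Function.Injective q.1) :
    DifferentiableAt ℂ (slice U) q := by
  have h1 : DifferentiableAt ℂ (fun r : Reduced n => Matrix.diagonal r.1) q := by
    refine differentiableAt_pi.2 fun i => differentiableAt_pi.2 fun j => ?_
    by_cases h : i = j
    · subst h
      simp only [Matrix.diagonal_apply_eq]
      fun_prop
    · simp only [Matrix.diagonal_apply_ne _ h]
      fun_prop
  have hf (i j : Fin n) : DifferentiableAt ℂ (fun r : Reduced n => r.2.2 i j) q :=
    differentiableAt_pi.1 (differentiableAt_pi.1 (differentiable_snd.snd q) i) j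
  have h2 : DifferentiableAt ℂ (fun r : Reduced n => cmMatrix r) q := by
    refine differentiableAt_pi.2 fun i => differentiableAt_pi.2 fun j => ?_
    by_cases h : i = j
    · subst h
      simp only [cmMatrix_apply_self]
      fun_prop
    · have h0 : q.1 i - q.1 j ≠ 0 := sub_ne_zero.2 (hq.ne h)
      simp only [cmMatrix_apply_ne _ h, div_eq_mul_inv]
      have hx : DifferentiableAt ℂ (fun r : Reduced n => r.1 i - r.1 j) q := by fun_prop
      exact (hf i j).fun_mul (hx.fun_inv h0)
  exact h1.prodMk ((differentiableAt_const U).prodMk h2)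

theorem isOpen_setOf_injective : IsOpen {q : Reduced n | Function.Injective q.1} := by
  have : {q : Reduced n | Function.Injective q.1} =
      ⋂ i : Fin n, ⋂ j : Fin n, ⋂ _ : i ≠ j, {q : Reduced n | q.1 i ≠ q.1 j} := by
    ext q
    simp only [Set.mem_ofPred_eq, Set.mem_iInter]
    exact ⟨fun h i j hij => h.ne hij, fun h i j hij => by_contra fun hne => h i j hne hij⟩
  rw [this]
  refine isOpen_iInter_of_finite fun i => isOpen_iInter_of_finite fun j =>
    isOpen_iInter_of_finite fun _ => isOpen_ne_fun ?_ ?_ <;> fun_prop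

/-- The trivialization can be moved to any invertible U without touching (x, p, f), so restriction
to U = 1 defines the reduced function. -/
theorem IsInvariant.apply_slice {F : Phase n → ℂ} (hF : IsInvariant F) {U : Mat n}
    (hU : IsUnit U.det) {r : Reduced n} (hr : Function.Injective r.1) :
    F (slice 1 r) = F (slice U r) := by
  rw [← hF (slice 1 r) (slice_mem_principalCell (by simp) hr) 1
    (Matrix.GeneralLinearGroup.mk'' U hU)]
  refine congrArg F ?_
  change ((1 : Mat n) * Matrix.diagonal r.1 * ((1⁻¹ : GL (Fin n) ℂ) : Mat n), (1 : Mat n) * 1 * U,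
    (1 : Mat n) * cmMatrix r * ((1⁻¹ : GL (Fin n) ℂ) : Mat n)) = _
  rw [inv_one, Units.val_one]
  simp only [one_mul, mul_one]
  rfl

theorem IsInvariant.fderiv_slice {F : Phase n → ℂ} (hF : IsInvariant F) {U : Mat n}
    (hU : IsUnit U.det) {q : Reduced n} (hq : Function.Injective q.1)
    (hd : DifferentiableAt ℂ F (slice U q)) (r : Reduced n) :
    fderiv ℂ (fun r => F (slice 1 r)) q r = fderiv ℂ F (slice U q) (dslice q r) := by
  have he : (fun r => F (slice 1 r)) =ᶠ[nhds q] fun r => F (slice U r) :=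
    Filter.eventually_of_mem (isOpen_setOf_injective.mem_nhds hq) fun r hr => hF.apply_slice hU hr
  rw [he.fderiv_eq]
  have h0 : q + (0 : ℂ) • r = q := by rw [zero_smul, add_zero]
  have hcomp : DifferentiableAt ℂ (fun r => F (slice U r)) q :=
    DifferentiableAt.comp q hd (differentiableAt_slice U hq)
  have hline : HasDerivAt (fun t : ℂ => q + t • r) r 0 := by
    have := ((hasDerivAt_id (0 : ℂ)).smul_const r).const_add q
    rwa [one_smul] at this
  have d1 : HasDerivAt (fun t : ℂ => F (slice U (q + t • r)))
      (fderiv ℂ (fun r => F (slice U r)) q r) 0 := by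
    refine HasFDerivAt.comp_hasDerivAt (0 : ℂ) (l := fun r => F (slice U r)) ?_ hline
    rw [h0]
    exact hcomp.hasFDerivAt
  have d2 : HasDerivAt (fun t : ℂ => F (slice U (q + t • r)))
      (fderiv ℂ F (slice U q) (dslice q r)) 0 := by
    refine HasFDerivAt.comp_hasDerivAt (0 : ℂ) (l := F) ?_ (hasDerivAt_slice U hq r)
    rw [h0]
    exact hd.hasFDerivAt
  exact d1.unique d2

/-! ### The Poisson bracket on the reduced space -/

/-- The off-diagonal matrix `β` with `[β, diag x]` the off-diagonal part of `c`; its diagonal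
vanishes by the convention for division by zero. -/
noncomputable def offDiagSolution (x : Fin n → ℂ) (c : Mat n) : Mat n :=
  Matrix.of fun i j => c i j / (x j - x i)

theorem trace_mul_diagonal_single (a : Mat n) (i : Fin n) :
    (a * Matrix.diagonal (Pi.single i 1)).trace = a i i := by
  rw [trace_mul_of_isDiag (Matrix.isDiag_diagonal _)]
  simp [Pi.single_apply]

section Gradient

variable {G : Phase n → ℂ} {U : Mat n} {q : Reduced n} {a c : Mat n}

theorem fderiv_slice_p (hG : ∀ r, fderiv ℂ (fun r => G (slice 1 r)) q r =
      (a * lam (dslice q r)).trace + (c * phi1 (dslice q r)).trace) (i : Fin n) :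
    fderiv ℂ (fun r => G (slice 1 r)) q (0, Pi.single i 1, 0) = c i i := by
  have h1 : lam (dslice q (0, Pi.single i 1, 0)) = 0 := by
    simp [lam, dslice]
  have h2 : phi1 (dslice q (0, Pi.single i 1, 0)) = Matrix.diagonal (Pi.single i 1) := by
    ext k l
    by_cases h : k = l <;> simp [phi1, dslice, h]
  rw [hG, h1, h2, trace_mul_diagonal_single, mul_zero, Matrix.trace_zero, zero_add]

theorem fderiv_slice_f (hq : Function.Injective q.1)
    (hG : ∀ r, fderiv ℂ (fun r => G (slice 1 r)) q r =
      (a * lam (dslice q r)).trace + (c * phi1 (dslice q r)).trace) (k l : Fin n) :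
    fderiv ℂ (fun r => G (slice 1 r)) q (0, 0, Matrix.single k l 1) =
      offDiagSolution q.1 c l k := by
  have h1 : lam (dslice q (0, 0, Matrix.single k l 1)) = 0 := by
    simp [lam, dslice]
  -- For k = l both sides are zero by division by zero, in accord with the diagonal of f being
  -- ignored.
  have h2 : phi1 (dslice q (0, 0, Matrix.single k l 1)) =
      Matrix.single k l (1 / (q.1 k - q.1 l)) := by
    ext i j
    by_cases h : i = j
    · subst h
      by_cases hki : k = i <;> by_cases hli : l = i <;>
        simp [phi1, dslice, Matrix.single_apply, hki, hli]
    · have : q.1 i - q.1 j ≠ 0 := sub_ne_zero.2 (hq.ne h)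
      by_cases hki : k = i <;> by_cases hli : l = j <;>
        simp [phi1, dslice, Matrix.single_apply, hki, hli, h]
      field_simp
  rw [hG, h1, h2, mul_zero, Matrix.trace_zero, zero_add, Matrix.trace_mul_single, offDiagSolution,
    Matrix.of_apply]
  simp [div_eq_mul_inv]

theorem fderiv_slice_x (hG : ∀ r, fderiv ℂ (fun r => G (slice 1 r)) q r =
      (a * lam (dslice q r)).trace + (c * phi1 (dslice q r)).trace) (i : Fin n) :
    fderiv ℂ (fun r => G (slice 1 r)) q (Pi.single i 1, 0, 0) = a i i +
      (offDiagSolution q.1 c * cmMatrix q - cmMatrix q * offDiagSolution q.1 c) i i := by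
  set β := offDiagSolution q.1 c with hβ
  have h1 : lam (dslice q (Pi.single i 1, 0, 0)) = Matrix.diagonal (Pi.single i 1) := rfl
  -- Moving x i also changes the denominators of `cmMatrix`. Their contribution, regrouped through
  -- β, is the diagonal entry of [β, Φ₁].
  have h2 (k l : Fin n) : c k l * phi1 (dslice q (Pi.single i 1, 0, 0)) l k =
      β k l * cmMatrix q l k * ((if k = i then 1 else 0) - (if l = i then 1 else 0)) := by
    by_cases h : l = k
    · subst h
      simp [phi1, dslice]
    · simp only [phi1, dslice, Matrix.of_apply, if_neg h, cmMatrix_apply_ne _ h, hβ,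
        offDiagSolution, Pi.single_apply, Pi.zero_apply, Matrix.zero_apply]
      rw [div_mul_div_comm, ← sq]
      ring
  rw [hG, h1, trace_mul_diagonal_single]
  congr 1
  simp only [Matrix.trace, Matrix.diag_apply, Matrix.mul_apply, h2, mul_sub, Matrix.sub_apply,
    Finset.sum_sub_distrib, mul_ite, mul_one, mul_zero]
  congr 1
  · rw [Finset.sum_comm]
    simp
  · simp [mul_comm]

end Gradient

/-- A continuous linear form on the reduced space in terms of its values on the basis. -/
theorem reduced_clm_apply (l : Reduced n →L[ℂ] ℂ) (r : Reduced n) :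
    l r = ∑ i, (l (Pi.single i 1, 0, 0) * r.1 i + l (0, Pi.single i 1, 0) * r.2.1 i) +
      ∑ i, ∑ j, l (0, 0, Matrix.single i j 1) * r.2.2 i j := by
  have h0 : r = (LinearMap.inl ℂ _ _ r.1 : Reduced n) +
      ((LinearMap.inr ℂ (Fin n → ℂ) _ (LinearMap.inl ℂ _ (Mat n) r.2.1) : Reduced n) +
        (LinearMap.inr ℂ (Fin n → ℂ) _ (LinearMap.inr ℂ (Fin n → ℂ) (Mat n) r.2.2) :
          Reduced n)) := by
    refine Prod.ext ?_ (Prod.ext ?_ ?_) <;> simp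
  have hpi (m : (Fin n → ℂ) →ₗ[ℂ] ℂ) (x : Fin n → ℂ) :
      m x = ∑ i, m (Pi.single i 1) * x i := by
    conv_lhs => rw [pi_eq_sum_univ' x]
    simp only [map_sum, map_smul, smul_eq_mul, mul_comm]
  have hmat (m : Mat n →ₗ[ℂ] ℂ) (x : Mat n) :
      m x = ∑ i, ∑ j, m (Matrix.single i j 1) * x i j := by
    conv_lhs => rw [Matrix.matrix_eq_sum_single x]
    simp only [map_sum]
    refine Finset.sum_congr rfl fun i _ => Finset.sum_congr rfl fun j _ => ?_
    rw [show Matrix.single i j (x i j) = x i j • Matrix.single i j (1 : ℂ) by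
      rw [Matrix.smul_single, smul_eq_mul, mul_one], map_smul, smul_eq_mul, mul_comm]
  have e1 := hpi ((l : Reduced n →ₗ[ℂ] ℂ).comp (LinearMap.inl ℂ _ _)) r.1
  have e2 := hpi ((l : Reduced n →ₗ[ℂ] ℂ).comp ((LinearMap.inr ℂ (Fin n → ℂ) _).comp
    (LinearMap.inl ℂ _ (Mat n)))) r.2.1
  have e3 := hmat ((l : Reduced n →ₗ[ℂ] ℂ).comp ((LinearMap.inr ℂ (Fin n → ℂ) _).comp
    (LinearMap.inr ℂ (Fin n → ℂ) (Mat n)))) r.2.2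
  conv_lhs => rw [h0, map_add, map_add]
  rw [Finset.sum_add_distrib, add_assoc]
  exact congrArg₂ (· + ·) e1 (congrArg₂ (· + ·) e2 e3)

/-- The Hamiltonian vector of a function with gradient `(a, c)`, moved along its orbit to a vector
which is tangent to the slice up to a change of trivialization. -/
theorem gradient_add_infGauge_eq {U : Mat n} {q : Reduced n} (hU : IsUnit U.det)
    (hq : Function.Injective q.1) (hf : ∀ i, q.2.2 i i = 0) {a c : Mat n}
    (h : lam (slice U q) * a - a * lam (slice U q) +
      (phi1 (slice U q) * c - c * phi1 (slice U q)) = 0) :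
    ((c, 0, -a) : Phase n) + infGauge (-offDiagSolution q.1 c) (slice U q) =
      dslice q (fun i => c i i, fun i => -(a i i + (offDiagSolution q.1 c * cmMatrix q -
        cmMatrix q * offDiagSolution q.1 c) i i),
        q.2.2 * offDiagSolution q.1 c - offDiagSolution q.1 c * q.2.2) +
      infFrame (-(U⁻¹ * offDiagSolution q.1 c * U)) (slice U q) := by
  set β := offDiagSolution q.1 c with hβ
  have hl : lam (slice U q) = Matrix.diagonal q.1 := rfl
  have hp : phi1 (slice U q) = cmMatrix q := rfl
  have hU' : frm (slice U q) = U := rfl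
  rw [hl, hp] at h
  have hL (i j : Fin n) (hij : i ≠ j) : β i j * (q.1 j - q.1 i) = c i j := by
    have : q.1 j - q.1 i ≠ 0 := sub_ne_zero.2 (hq.ne hij.symm)
    simp only [hβ, offDiagSolution, Matrix.of_apply]
    field_simp
  have hΦ (i j : Fin n) (hij : i ≠ j) : (q.1 i - q.1 j) * cmMatrix q i j = q.2.2 i j := by
    have : q.1 i - q.1 j ≠ 0 := sub_ne_zero.2 (hq.ne hij)
    rw [cmMatrix_apply_ne _ hij]
    field_simp
  -- The gauge direction -β cancels the off-diagonal part of c, so Λ stays diagonal.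
  have h1 : c + (-β * Matrix.diagonal q.1 - Matrix.diagonal q.1 * -β) =
      Matrix.diagonal fun i => c i i := by
    ext i j
    rw [Matrix.add_apply, Matrix.sub_apply, Matrix.mul_diagonal, Matrix.diagonal_mul]
    by_cases hij : i = j
    · subst hij
      rw [Matrix.diagonal_apply_eq]
      ring
    · rw [Matrix.diagonal_apply_ne _ hij, Matrix.neg_apply]
      linear_combination -hL i j hij
  set Y := -a + (-β * cmMatrix q - cmMatrix q * -β) with hY
  -- The variation of Φ₂ along the corrected vector: the gradient part contributes nothing by h, the
  -- gauge part [-β, f]. Off the diagonal this determines Y after division by x i - x j.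
  have h2 : (Matrix.diagonal fun i => c i i) * cmMatrix q + Matrix.diagonal q.1 * Y -
      (Y * Matrix.diagonal q.1 + cmMatrix q * Matrix.diagonal fun i => c i i) =
      q.2.2 * β - β * q.2.2 := by
    have h3 : Matrix.diagonal q.1 * cmMatrix q - cmMatrix q * Matrix.diagonal q.1 = q.2.2 :=
      phi2_slice U hq hf
    rw [← h1, ← h3, ← sub_eq_zero, hY, ← neg_eq_zero, ← h]
    noncomm_ring
  refine Prod.ext ?_ (Prod.ext ?_ ?_)
  · change c + (-β * Matrix.diagonal q.1 - Matrix.diagonal q.1 * -β) =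
      (Matrix.diagonal fun i => c i i) + 0
    rw [h1, add_zero]
  · change 0 + -β * U = 0 + U * -(U⁻¹ * β * U)
    rw [mul_neg, ← mul_assoc, ← mul_assoc, Matrix.mul_nonsing_inv _ hU, one_mul, neg_mul]
  · change Y = _ + 0
    rw [add_zero]
    ext i j
    by_cases hij : i = j
    · subst hij
      simp only [hY, dslice, Matrix.of_apply, if_true, Matrix.add_apply, Matrix.sub_apply,
        neg_mul, mul_neg, Matrix.neg_apply]
      ring
    · have h0 : q.1 i - q.1 j ≠ 0 := sub_ne_zero.2 (hq.ne hij)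
      have h4 := congrFun (congrFun h2 i) j
      simp only [Matrix.sub_apply (_ * _ + _), Matrix.add_apply, Matrix.diagonal_mul,
        Matrix.mul_diagonal] at h4
      simp only [dslice, Matrix.of_apply, if_neg hij]
      rw [eq_div_iff (pow_ne_zero 2 h0), ← h4, ← hΦ i j hij]
      ring

/-- Orbit directions do not affect dF, so only the slice component counts. There x' = ∂G/∂p, p' =
-∂G/∂x and f' = [f, β], where β is the transposed matrix of the ∂G/∂f; this is the Lie-Poisson flow.
-/
theorem fderiv_eq_spinBracket {F G : Phase n → ℂ} (hF : IsInvariant F) {U : Mat n}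
    {q : Reduced n} (hU : IsUnit U.det) (hq : Function.Injective q.1) (hf : ∀ i, q.2.2 i i = 0)
    (hdF : DifferentiableAt ℂ F (slice U q)) {a c : Mat n}
    (hG : ∀ r, fderiv ℂ (fun r => G (slice 1 r)) q r =
      (a * lam (dslice q r)).trace + (c * phi1 (dslice q r)).trace)
    (h : lam (slice U q) * a - a * lam (slice U q) +
      (phi1 (slice U q) * c - c * phi1 (slice U q)) = 0) :
    fderiv ℂ F (slice U q) (c, 0, -a) =
      spinBracket (fun r => F (slice 1 r)) (fun r => G (slice 1 r)) q := by
  have hs := slice_mem_principalCell hU hq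
  set β := offDiagSolution q.1 c with hβ
  have e0 := congrArg (fderiv ℂ F (slice U q)) (gradient_add_infGauge_eq hU hq hf h)
  rw [map_add, map_add, hF.fderiv_infGauge hs hdF, hF.fderiv_infFrame hs hdF, add_zero, add_zero,
    ← hF.fderiv_slice hU hq hdF, reduced_clm_apply] at e0
  rw [e0, spinBracket]
  congr 1
  · refine Finset.sum_congr rfl fun i _ => ?_
    rw [fderiv_slice_p hG, fderiv_slice_x hG]
    ring
  · refine Finset.sum_congr rfl fun i _ => Finset.sum_congr rfl fun j _ => ?_
    simp only [fderiv_slice_f hq hG, mul_assoc, ← Finset.mul_sum]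
    congr 1
    simp only [Matrix.sub_apply, Matrix.mul_apply, mul_sub, Finset.sum_sub_distrib, mul_ite,
      mul_zero]
    congr 1
    · rw [Finset.sum_comm]
      simp [mul_comm]
    · simp

/-- Since ω is degenerate on triples, Hamiltonian vectors are not unique. Two of them differ by a
gauge direction, which dF annihilates, so the bracket is well defined. -/
theorem hamiltonianVector_slice (hz : z₁ ≠ z₂) {θ : Phase n → Phase n →L[ℂ] ℂ}
    (hθ : IsCanonicalOneForm z₁ z₂ θ) {F G : Phase n → ℂ} (hF : IsInvariant F)
    (hG : IsInvariant G) {U : Mat n} {q : Reduced n} (hU : IsUnit U.det)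
    (hq : Function.Injective q.1) (hf : ∀ i, q.2.2 i i = 0)
    (hdF : DifferentiableAt ℂ F (slice U q)) (hdG : DifferentiableAt ℂ G (slice U q)) :
    (∃ X, IsHamiltonianVector θ (slice U q) G X) ∧
      ∀ X, IsHamiltonianVector θ (slice U q) G X → fderiv ℂ F (slice U q) X =
        spinBracket (fun r => F (slice 1 r)) (fun r => G (slice 1 r)) q := by
  have hs := slice_mem_principalCell hU hq
  have hU' : IsUnit (frm (slice U q)).det := hU
  obtain ⟨a, c, hac, h⟩ := hG.exists_fderiv_eq hs hdG
  have hX0 : IsHamiltonianVector θ (slice U q) G (c, 0, -a) := fun w => by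
    rw [hθ.extD_eq hz hU', omega_of_gradient hU' h, hac]
  refine ⟨⟨_, hX0⟩, fun X hX => ?_⟩
  obtain ⟨ξ, hξ⟩ := (omega_eq_zero_iff hU' (X - (c, 0, -a))).1 fun w => by
    rw [omega_sub, ← hθ.extD_eq hz hU', ← hθ.extD_eq hz hU', hX w, hX0 w, sub_self]
  rw [eq_add_of_sub_eq' hξ, map_add, hF.fderiv_infGauge hs hdF, add_zero]
  exact fderiv_eq_spinBracket hF hU hq hf hdF
    (fun r => by rw [hG.fderiv_slice hU hq hdG, hac]) h

end CuspHitchin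

open CuspHitchin in
theorem mainTheorem10 (n : ℕ) (z₁ z₂ : ℂ) (hz : z₁ ≠ z₂) :
    -- Higgs fields
    (∀ (L : Mat n) (F : RMat n), IsHiggs z₁ z₂ L F ↔
      ∃! A : Mat n × Mat n × Mat n, F = laxForm z₁ z₂ A.1 A.2.1 A.2.2 ∧
        A.2.1 = L * A.1 - A.1 * L ∧ A.2.2 = -A.2.1) ∧
    -- points of the cotangent bundle are orbits of triples under simultaneous conjugation
    (∀ s s' : Phase n, IsUnit (frm s).det → IsUnit (frm s').det →
      (TripleIso z₁ z₂ (lam s) (frm s) (higgs z₁ z₂ s) (lam s') (frm s') (higgs z₁ z₂ s') ↔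
        ∃ g : GL (Fin n) ℂ, s' = act g 1 s)) ∧
    -- the first cohomology group is the tangent space of the moduli space
    (∀ L U : Mat n, IsUnit U.det →
      (∀ L' U', ∃ χ, IsKodairaSpencer z₁ z₂ L U L' U' χ) ∧
      (∀ χ : RMat n, IsCochain z₁ z₂ χ ↔ ∃ L' U', IsKodairaSpencer z₁ z₂ L U L' U' χ) ∧
      (∀ L' U' χ, IsKodairaSpencer z₁ z₂ L U L' U' χ →
        (IsCoboundary z₁ z₂ L χ ↔ ∃ ξ : Mat n, L' = ξ * L - L * ξ ∧ U' = ξ * U))) ∧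
    -- the space of Higgs fields is its dual under the Serre pairing
    (∀ L : Mat n,
      (∀ χ : RMat n, IsCochain z₁ z₂ χ →
        (IsCoboundary z₁ z₂ L χ ↔ ∀ F, IsHiggs z₁ z₂ L F → serrePairing z₁ z₂ F χ = 0)) ∧
      (∀ F : RMat n, IsHiggs z₁ z₂ L F →
        (∀ χ, IsCochain z₁ z₂ χ → serrePairing z₁ z₂ F χ = 0) → F = 0)) ∧
    -- the canonical one-form exists
    (∃ θ : Phase n → Phase n →L[ℂ] ℂ, IsCanonicalOneForm z₁ z₂ θ) ∧
    (∀ θ : Phase n → Phase n →L[ℂ] ℂ, IsCanonicalOneForm z₁ z₂ θ →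
      -- the canonical one-form and the symplectic form; they descend to the cotangent bundle
      (∀ s : Phase n, IsUnit (frm s).det →
        (∀ v, θ s v = (phi1 s * lam v).trace - ((frm s)⁻¹ * phi2 s * frm v).trace) ∧
        (∀ v w, extD θ s v w =
          trWedge phi1 lam s v w - trWedge (fun t => (frm t)⁻¹ * phi2 t) frm s v w) ∧
        (∀ v, (∀ w, extD θ s v w = 0) ↔ ∃ ξ : Mat n, v = infGauge ξ s) ∧
        (∀ ξ : Mat n, θ s (infGauge ξ s) = 0) ∧
        (∀ (g h : GL (Fin n) ℂ) v, θ (act g h s) (act g h v) = θ s v) ∧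
        -- the moment map of the changes of trivialization
        (∀ A : Mat n, θ s (infFrame A s) = (moment s * A).trace ∧
          IsHamiltonianVector θ s (fun t => (moment t * A).trace) (infFrame A s))) ∧
      -- coordinates on the reduced space at the moment level `ν`
      (∀ (ν : Mat n), ∀ s ∈ principalCell n, moment s = ν →
        ∃ (g : GL (Fin n) ℂ) (U : Mat n) (q : Reduced n), act g 1 s = slice U q ∧
          Function.Injective q.1 ∧ (∀ i, q.2.2 i i = 0) ∧ q.2.2 = -(U * ν * U⁻¹)) ∧
      (∀ (U : Mat n) (q : Reduced n), IsUnit U.det → Function.Injective q.1 →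
        (∀ i, q.2.2 i i = 0) →
        slice U q ∈ principalCell n ∧
        phi2 (slice U q) = q.2.2 ∧
        moment (slice U q) = -(U⁻¹ * q.2.2 * U) ∧
        -- the symplectic form on a moment level
        (∀ v w : Phase n, (lam v).IsDiag → (lam w).IsDiag →
          fderiv ℂ moment (slice U q) v = 0 → fderiv ℂ moment (slice U q) w = 0 →
          extD θ (slice U q) v w =
            ∑ i, (phi1 v i i * lam w i i - phi1 w i i * lam v i i) -
              (moment (slice U q) * ((U⁻¹ * frm v) * (U⁻¹ * frm w) -
                (U⁻¹ * frm w) * (U⁻¹ * frm v))).trace) ∧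
        -- the Poisson bracket `{F, G} = dF(X_G)` of functions on the reduced space
        (∀ F G : Phase n → ℂ, IsInvariant F → IsInvariant G →
          DifferentiableAt ℂ F (slice U q) → DifferentiableAt ℂ G (slice U q) →
          (∃ X, IsHamiltonianVector θ (slice U q) G X) ∧
          ∀ X, IsHamiltonianVector θ (slice U q) G X →
            fderiv ℂ F (slice U q) X =
              spinBracket (fun r => F (slice 1 r)) (fun r => G (slice 1 r)) q) ∧
        -- the spin rational Calogero-Moser Hamiltonian
        (phi1 (slice U q) * phi1 (slice U q)).trace =
          ∑ i, q.2.1 i ^ 2 -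
            ∑ ij ∈ (Finset.univ : Finset (Fin n)).offDiag,
              q.2.2 ij.1 ij.2 * q.2.2 ij.2 ij.1 / (q.1 ij.1 - q.1 ij.2) ^ 2)) ∧
    -- the Hamiltonian is a Hitchin Hamiltonian and is invariant
    (∀ s : Phase n, coeffAt z₁ (-4) (higgs z₁ z₂ s * higgs z₁ z₂ s).trace =
      (phi1 s * phi1 s).trace) ∧
    IsInvariant (fun s : Phase n => (phi1 s * phi1 s).trace) := by
  refine ⟨isHiggs_iff_existsUnique hz, fun s s' _ _ => tripleIso_iff hz s s', fun L U hU =>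
    ⟨exists_isKodairaSpencer hz L hU, isCochain_iff L U, fun L' U' χ h => h.isCoboundary_iff hU⟩,
    fun L => ⟨fun χ => isCoboundary_iff_serrePairing_eq_zero hz L,
      fun F hF => hF.eq_zero_of_serrePairing_eq_zero hz⟩,
    ⟨canonicalForm, isCanonicalOneForm_canonicalForm hz⟩,
    fun θ hθ => ⟨fun s hs => ⟨hθ.apply hz hs, fun v w => ?_, fun v => ?_, fun ξ => ?_,
      fun g h v => ?_, fun A => ⟨?_, fun w => ?_⟩⟩, ?_,
      fun U q hU hq hf => ⟨slice_mem_principalCell hU hq, phi2_slice U hq hf, ?_, ?_,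
        fun F G hF hG hdF hdG => hamiltonianVector_slice hz hθ hF hG hU hq hf hdF hdG,
        trace_cmMatrix_mul_self q⟩⟩,
    coeffAt_trace_higgs_sq hz, isInvariant_trace_phi1_sq⟩
  · rw [hθ.extD_eq hz hs, trWedge, trWedge, fderiv_coframe hs, fderiv_coframe hs, fderiv_frm,
      fderiv_frm, fderiv_phi1, fderiv_phi1, fderiv_lam, fderiv_lam, omega]
  · simp only [hθ.extD_eq hz hs]
    exact omega_eq_zero_iff hs v
  · rw [hθ.apply hz hs, canonicalForm_infGauge hs]
  · rw [hθ.apply hz (isUnit_det_frm_act g h hs), hθ.apply hz hs, canonicalForm_act]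
  · rw [hθ.apply hz hs, canonicalForm_infFrame]
  · rw [hθ.extD_eq hz hs, omega_infFrame hs]
  · rintro ν s hs rfl
    exact exists_act_eq_slice hs
  · rw [moment, phi2_slice U hq hf]
    rfl
  · intro v w hv hw hv' hw'
    have hU' : IsUnit (frm (slice U q)).det := hU
    rw [hθ.extD_eq hz hU', omega_of_fderiv_moment_eq_zero hU' hv hw hv' hw']
    rfl
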